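/- Let $\mu$ be a $\sigma$-finite positive measure on $X$ and let $L^2=L^2(X,\mu)$ be the complex Hilbert space of square-integrable functions. A bounded operator $A$ on $L^2$ is a positive kernel operator if it maps nonnegative functions to nonnegative functions and there is a $\mu\times\mu$-measurable kernel $k$ such that for every $f\in L^2$ and almost every $x$, $\int_X|k(x,y)f(y)|\,d\mu(y)<\infty$ and $(Af)(x)=\int_X k(x,y)f(y)\,d\mu(y)$. The kernel is then nonnegative almost everywhere. For positive kernel operators $A,B$ with nonnegative kernels $a,b$ and $\alpha\in[0,1]$, let $A^{(\alpha)}\circ B^{(1-\alpha)}$ be the positive kernel operator with kernel $a(x,y)^\alpha b(x,y)^{1-\alpha}$ (with $0^0=1$). For a set $\Psi$ of positive kernel operators put $$S_\alpha(\Psi)=\{A^{(\alpha)}\circ (B^*)^{(1-\alpha)} : A,B\in\Psi\}.$$ Sums and products of sets of operators are elementwise: $\Psi+\Sigma=\{A+B\}$, $\Psi\Sigma=\{AB\}$ with $A\in\Psi$, $B\in\Sigma$, and $\Sigma^k=\{A_1\cdots A_k: A_i\in\Sigma\}$. For a bounded operator $A$ let $r(A)$ be its spectral radius, $r_{ess}(A)$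 the spectral radius of its image in the Calkin algebra, $w(A)=\sup\{|\langle Af,f\rangle| : \|f\|=1\}$, and $\gamma(A)$ its Hausdorff measure of non-compactness: the infimum of all $\delta>0$ such that $A(D)\subseteq M+\delta D$ for some finite set $M\subset L^2$, where $D$ is the closed unit ball. For a bounded set $\Sigma$ of bounded operators let $$r(\Sigma)=\limsup_{k\to\infty}\Bigl[\sup_{A\in\Sigma^k}r(A)\Bigr]^{1/k},\qquad \hat r(\Sigma)=\lim_{k\to\infty}\Bigl[\sup_{A\in\Sigma^k}\|A\|\Bigr]^{1/k},$$ $$r_{ess}(\Sigma)=\limsup_{k\to\infty}\Bigl[\sup_{A\in\Sigma^k}r_{ess}(A)\Bigr]^{1/k},\qquad \hat r_{ess}(\Sigma)=\lim_{k\to\infty}\Bigl[\sup_{A\in\Sigma^k}\gamma(A)\Bigr]^{1/k},$$ $$\|\Sigma\|=\sup_{A\in\Sigma}\|A\|,\qquad \gamma(\Sigma)=\sup_{A\in\Sigma}\gamma(A),\qquad w(\Sigma)=\sup_{A\in\Sigma}w(A)$$ (a supremum over the empty set being $0$). **Theorem.** Let $\Psi_{ij}$, $i=1,\dots,n$, $j=1,\dots,m$,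 be bounded sets of positive kernel operators on $L^2(X,\mu)$ and let $\rho\in\{r,\hat r,r_{ess},\hat r_{ess},\|\cdot\|,\gamma,w\}$. For $\alpha\in[0,1]$ define $$\overline{\rho}_n(\alpha)=\rho\Bigl(\bigl(S_\alpha(\Psi_{11})+\cdots+S_\alpha(\Psi_{1m})\bigr)\cdots\bigl(S_\alpha(\Psi_{n1})+\cdots+S_\alpha(\Psi_{nm})\bigr)\Bigr)^{1/2}\,\rho\Bigl(\bigl(S_\alpha(\Psi_{n1})+\cdots+S_\alpha(\Psi_{nm})\bigr)\cdots\bigl(S_\alpha(\Psi_{11})+\cdots+S_\alpha(\Psi_{1m})\bigr)\Bigr)^{1/2}.$$ Then $\overline{\rho}_n(\alpha)<\infty$ and $$\overline{\rho}_n(\alpha)\le\rho\bigl((\Psi_{11}+\cdots+\Psi_{1m})\cdots(\Psi_{n1}+\cdots+\Psi_{nm})\bigr)^{1/2}\,\rho\bigl((\Psi_{n1}+\cdots+\Psi_{nm})\cdots(\Psi_{11}+\cdots+\Psi_{1m})\bigr)^{1/2}$$ for each $\alpha\in[0,1]$. Moreover, $\overline{\rho}_n$ is decreasing on $[0,\tfrac12]$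 and increasing on $[\tfrac12,1]$ (in the weak sense). -/

import Mathlib

open scoped Pointwise ENNReal NNReal

namespace KernelOp

noncomputable section

/-! ### Spectral quantities of a single bounded operator -/

section Banach

variable {E : Type*} [NormedAddCommGroup E] [NormedSpace ℂ E]

/-- The two-sided ideal of compact operators in the algebra of bounded operators on `E`. -/
def compactIdeal (E : Type*) [NormedAddCommGroup E] [NormedSpace ℂ E] :
    TwoSidedIdeal (E →L[ℂ] E) :=
  TwoSidedIdeal.mk' {T : E →L[ℂ] E | IsCompactOperator T}
    isCompactOperator_zero
    (fun hx hy => hx.add hy)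
    (fun hx => hx.neg)
    (fun {x _} hy => hy.clm_comp x)
    (fun {_ y} hx => hx.comp_clm y)

/-- The Calkin algebra: bounded operators modulo compact operators. -/
abbrev Calkin (E : Type*) [NormedAddCommGroup E] [NormedSpace ℂ E] : Type _ :=
  (compactIdeal E).ringCon.Quotient

/-- The essential spectral radius: the spectral radius of the image in the Calkin algebra. -/
def essRadius (A : E →L[ℂ] E) : ℝ≥0∞ :=
  spectralRadius ℂ (A : Calkin E)

/-- The Hausdorff measure of non-compactness of an operator: the infimum of all `δ > 0` such
that the image of the closed unit ball `D` is contained in `M + δ D` for a finite set `M`. -/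
def hausdorffMeas (A : E →L[ℂ] E) : ℝ≥0∞ :=
  ⨅ (δ : ℝ≥0) (_ : 0 < δ) (_ : ∃ M : Set E, M.Finite ∧
    A '' Metric.closedBall 0 1 ⊆ M + (δ : ℝ) • Metric.closedBall (0 : E) 1), (δ : ℝ≥0∞)

/-! ### The corresponding quantities for a set of operators

All suprema are taken in `[0, ∞]`, so that the supremum over the empty set is `0`.
For a set `Ψ`, the pointwise power `Ψ ^ m` is `{A₁ ⋯ Aₘ : Aᵢ ∈ Ψ}`. -/

/-- The generalized spectral radius `r(Ψ)`. -/
def genRadius (Ψ : Set (E →L[ℂ] E)) : ℝ≥0∞ :=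
  Filter.limsup (fun m : ℕ => (⨆ A ∈ Ψ ^ m, spectralRadius ℂ A) ^ (1 / (m : ℝ))) Filter.atTop

/-- The joint spectral radius `r̂(Ψ)`. For a bounded set `Ψ` the sequence converges
(it is the root sequence of a submultiplicative sequence), so the upper limit is the limit. -/
def jointRadius (Ψ : Set (E →L[ℂ] E)) : ℝ≥0∞ :=
  Filter.limsup (fun m : ℕ => (⨆ A ∈ Ψ ^ m, ‖A‖ₑ) ^ (1 / (m : ℝ))) Filter.atTop

/-- The generalized essential spectral radius `r_ess(Ψ)`. -/
def genEssRadius (Ψ : Set (E →L[ℂ] E)) : ℝ≥0∞ :=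
  Filter.limsup (fun m : ℕ => (⨆ A ∈ Ψ ^ m, essRadius A) ^ (1 / (m : ℝ))) Filter.atTop

/-- The joint essential spectral radius `r̂_ess(Ψ)`. For a bounded set `Ψ` the sequence
converges (it is the root sequence of a submultiplicative sequence), so the upper limit is
the limit. -/
def jointEssRadius (Ψ : Set (E →L[ℂ] E)) : ℝ≥0∞ :=
  Filter.limsup (fun m : ℕ => (⨆ A ∈ Ψ ^ m, hausdorffMeas A) ^ (1 / (m : ℝ))) Filter.atTop

/-- `‖Ψ‖ = sup_{A ∈ Ψ} ‖A‖`. -/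
def supNorm (Ψ : Set (E →L[ℂ] E)) : ℝ≥0∞ := ⨆ A ∈ Ψ, ‖A‖ₑ

/-- `γ(Ψ) = sup_{A ∈ Ψ} γ(A)`. -/
def supHausdorffMeas (Ψ : Set (E →L[ℂ] E)) : ℝ≥0∞ := ⨆ A ∈ Ψ, hausdorffMeas A

end Banach

section Hilbert

variable {H : Type*} [NormedAddCommGroup H] [InnerProductSpace ℂ H]

/-- The numerical radius `w(A) = sup {|⟨A f, f⟩| : ‖f‖ = 1}`. -/
def numRadius (A : H →L[ℂ] H) : ℝ≥0∞ :=
  ⨆ (f : H) (_ : ‖f‖ = 1), ‖inner ℂ (A f) f‖ₑ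

/-- `w(Ψ) = sup_{A ∈ Ψ} w(A)`. -/
def supNumRadius (Ψ : Set (H →L[ℂ] H)) : ℝ≥0∞ := ⨆ A ∈ Ψ, numRadius A

end Hilbert

/-! ### Positive kernel operators on `L²` -/

section L2

open MeasureTheory

variable {X : Type*} [MeasurableSpace X] {μ : Measure X}

/-- Bounded operators on the complex Hilbert space `L²(X, μ)`. -/
abbrev Op (μ : Measure X) : Type _ := Lp ℂ 2 μ →L[ℂ] Lp ℂ 2 μ

/-- The operator maps (a.e.) nonnegative functions to (a.e.) nonnegative functions. -/
def IsPositiveOp (A : Op μ) : Prop :=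
  ∀ f : Lp ℂ 2 μ, (∀ᵐ x ∂μ, 0 ≤ (f x).re ∧ (f x).im = 0) →
    ∀ᵐ x ∂μ, 0 ≤ (A f x).re ∧ (A f x).im = 0

/-- `k` is a kernel of the operator `A`. -/
structure HasKernel (A : Op μ) (k : X → X → ℂ) : Prop where
  aestronglyMeasurable : AEStronglyMeasurable (fun p : X × X => k p.1 p.2) (μ.prod μ)
  integrable : ∀ f : Lp ℂ 2 μ, ∀ᵐ x ∂μ, Integrable (fun y => k x y * f y) μ
  apply_eq : ∀ f : Lp ℂ 2 μ, ∀ᵐ x ∂μ, A f x = ∫ y, k x y * f y ∂μ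

/-- Positive kernel operators on `L²(X, μ)`. -/
def IsPosKernelOp (A : Op μ) : Prop :=
  IsPositiveOp A ∧ ∃ k : X → X → ℂ, HasKernel A k

/-- Existence of the Hadamard weighted geometric mean of two operators with nonnegative
kernels. -/
theorem exists_hasKernel_mean [SigmaFinite μ] {α β : ℝ} (hα : 0 ≤ α) (hβ : 0 ≤ β)
    (hαβ : α + β = 1) {A B : Op μ} {a b : X → X → ℝ≥0}
    (hA : HasKernel A (fun x y => ((a x y : ℝ) : ℂ)))
    (hB : HasKernel B (fun x y => ((b x y : ℝ) : ℂ))) :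
    ∃ T : Op μ, HasKernel T (fun x y => (((a x y) ^ α * (b x y) ^ β : ℝ≥0) : ℂ)) := by
  set k : X → X → ℂ := fun x y => (((a x y) ^ α * (b x y) ^ β : ℝ≥0) : ℂ) with hk
  have hle : ∀ x y, ‖k x y‖ ≤ (a x y : ℝ) + b x y := by
    intro x y
    have h1 := Real.geom_mean_le_arith_mean2_weighted hα hβ (a x y).2 (b x y).2 hαβ
    have h2 : ‖k x y‖ = (a x y : ℝ) ^ α * (b x y : ℝ) ^ β := by
      simp only [hk, Complex.norm_real, Real.norm_eq_abs]
      rw [abs_of_nonneg (NNReal.coe_nonneg _)]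
      simp
    rw [h2]
    refine h1.trans ?_
    have ha := (a x y).2
    have hb := (b x y).2
    have := mul_le_of_le_one_left ha (by linarith : α ≤ 1)
    have := mul_le_of_le_one_left hb (by linarith : β ≤ 1)
    exact add_le_add ‹_› ‹_›
  have hmk : AEStronglyMeasurable (fun p : X × X => k p.1 p.2) (μ.prod μ) := by
    have ham : AEMeasurable (fun p : X × X => a p.1 p.2) (μ.prod μ) := by
      have := hA.aestronglyMeasurable.norm.aemeasurable.real_toNNReal
      simpa using this
    have hbm : AEMeasurable (fun p : X × X => b p.1 p.2) (μ.prod μ) := by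
      have := hB.aestronglyMeasurable.norm.aemeasurable.real_toNNReal
      simpa using this
    have h3 : AEMeasurable (fun p : X × X => (a p.1 p.2) ^ α * (b p.1 p.2) ^ β) (μ.prod μ) :=
      (ham.pow_const α).mul (hbm.pow_const β)
    exact (Complex.measurable_ofReal.comp_aemeasurable h3.coe_nnreal_real).aestronglyMeasurable
  -- the modulus of an element of `L²`
  let ab : Lp ℂ 2 μ → Lp ℂ 2 μ := fun f =>
    MemLp.toLp (fun x => ((‖f x‖ : ℝ) : ℂ)) (Lp.memLp f).norm.ofReal
  have hab : ∀ f, ∀ᵐ y ∂μ, ab f y = ((‖f y‖ : ℝ) : ℂ) := fun f => MemLp.coeFn_toLp _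
  have habn : ∀ f, ‖ab f‖ = ‖f‖ := by
    intro f
    refine le_antisymm (Lp.norm_le_norm_of_ae_le ?_) (Lp.norm_le_norm_of_ae_le ?_) <;>
    · filter_upwards [hab f] with y hy
      simp [hy]
  have hsec : ∀ᵐ x ∂μ, AEStronglyMeasurable (fun y => k x y) μ := hmk.prodMk_left
  -- integrability and the pointwise bound
  have key : ∀ f : Lp ℂ 2 μ, ∀ᵐ x ∂μ, Integrable (fun y => k x y * f y) μ ∧
      ‖∫ y, k x y * f y ∂μ‖ ≤ ‖((A + B) (ab f)) x‖ := by
    intro f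
    filter_upwards [hA.integrable (ab f), hB.integrable (ab f), hA.apply_eq (ab f),
      hB.apply_eq (ab f), hsec, Lp.coeFn_add (A (ab f)) (B (ab f))] with x h1 h2 h3 h4 h5 h6
    have h7 : Integrable (fun y => ((a x y : ℝ) + b x y) * ‖f y‖) μ := by
      have := (h1.add h2).norm
      refine this.congr ?_
      filter_upwards [hab f] with y hy
      simp only [Pi.add_apply, hy, ← add_mul, ← Complex.ofReal_add, ← Complex.ofReal_mul,
        Complex.norm_real, Real.norm_eq_abs]
      exact abs_of_nonneg (by positivity)
    have h8 : ∀ y, ‖k x y * f y‖ ≤ ((a x y : ℝ) + b x y) * ‖f y‖ := fun y => by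
      rw [norm_mul]
      exact mul_le_mul_of_nonneg_right (hle x y) (norm_nonneg _)
    refine ⟨h7.mono' (h5.mul (Lp.aestronglyMeasurable f)) (.of_forall h8), ?_⟩
    have h9 : ((A + B) (ab f)) x = ((∫ y, ((a x y : ℝ) + b x y) * ‖f y‖ ∂μ : ℝ) : ℂ) := by
      rw [_root_.add_apply, h6, Pi.add_apply, h3, h4, ← integral_add h1 h2,
        ← integral_complex_ofReal]
      refine integral_congr_ae ?_
      filter_upwards [hab f] with y hy
      simp [hy, add_mul]
    rw [h9, Complex.norm_real, Real.norm_eq_abs]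
    exact (norm_integral_le_of_norm_le h7 (.of_forall h8)).trans (le_abs_self _)
  have hmeas : ∀ f : Lp ℂ 2 μ, AEStronglyMeasurable (fun x => ∫ y, k x y * f y ∂μ) μ := by
    intro f
    exact (hmk.mul (Lp.aestronglyMeasurable f).comp_snd).integral_prod_right'
  have hLp : ∀ f : Lp ℂ 2 μ, MemLp (fun x => ∫ y, k x y * f y ∂μ) 2 μ := fun f =>
    (Lp.memLp ((A + B) (ab f))).mono (hmeas f) ((key f).mono fun x hx => hx.2)
  let L : Lp ℂ 2 μ →ₗ[ℂ] Lp ℂ 2 μ :=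
    { toFun := fun f => (hLp f).toLp _
      map_add' := by
        intro f g
        rw [← MemLp.toLp_add]
        refine (MemLp.toLp_eq_toLp_iff _ _).2 ?_
        filter_upwards [key f, key g] with x hf hg
        rw [Pi.add_apply, ← integral_add hf.1 hg.1]
        refine integral_congr_ae ?_
        filter_upwards [Lp.coeFn_add f g] with y hy
        rw [hy, Pi.add_apply, mul_add]
      map_smul' := by
        intro c f
        rw [RingHom.id_apply, ← MemLp.toLp_const_smul]
        refine (MemLp.toLp_eq_toLp_iff _ _).2 ?_
        refine .of_forall fun x => ?_
        simp only [Pi.smul_apply, smul_eq_mul]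
        rw [← integral_const_mul]
        refine integral_congr_ae ?_
        filter_upwards [Lp.coeFn_smul c f] with y hy
        rw [hy, Pi.smul_apply, smul_eq_mul]
        ring }
  refine ⟨L.mkContinuous ‖A + B‖ ?_, hmk, fun f => (key f).mono fun x hx => hx.1,
    fun f => MemLp.coeFn_toLp (hLp f)⟩
  intro f
  rw [← habn f]
  refine le_trans (Lp.norm_le_norm_of_ae_le ?_) ((A + B).le_opNorm (ab f))
  filter_upwards [key f, MemLp.coeFn_toLp (hLp f)] with x hx hx'
  exact (congrArg norm hx').le.trans hx.2

/-- `T = A^(α) ∘ B^(β)`: the operators `A` and `B` have nonnegative kernels `a` and `b`, and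
`T` has the kernel `a(x,y)^α b(x,y)^β`, where `0^0 = 1`. For positive kernel operators on
a `σ`-finite space, `a` and `b` exist and are determined up to null sets, so that `T` is
determined by `A` and `B`; it exists by `exists_hasKernel_mean` if `α, β ≥ 0`, `α + β = 1`. -/
def IsHadamardMean (α β : ℝ) (A B T : Op μ) : Prop :=
  ∃ a b : X → X → ℝ≥0,
    HasKernel A (fun x y => ((a x y : ℝ) : ℂ)) ∧ HasKernel B (fun x y => ((b x y : ℝ) : ℂ)) ∧
      HasKernel T (fun x y => (((a x y) ^ α * (b x y) ^ β : ℝ≥0) : ℂ))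

/-- The weighted Hadamard mean `Ψ^(α) ∘ Σ^(β) = {A^(α) ∘ B^(β) : A ∈ Ψ, B ∈ Σ}`. -/
def hadamardMean (α β : ℝ) (Ψ Φ : Set (Op μ)) : Set (Op μ) :=
  {T | ∃ A ∈ Ψ, ∃ B ∈ Φ, IsHadamardMean α β A B T}

/-- `Ψ* = {A* : A ∈ Ψ}`, where `A*` is the Hilbert space adjoint. -/
def adjointSet (Ψ : Set (Op μ)) : Set (Op μ) :=
  {T | ∃ A ∈ Ψ, T = ContinuousLinearMap.adjoint A}

/-- The weighted geometric symmetrization `S_α(Ψ) = Ψ^(α) ∘ (Ψ*)^(1-α)`. -/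
def geomSymm (α : ℝ) (Ψ : Set (Op μ)) : Set (Op μ) :=
  hadamardMean α (1 - α) Ψ (adjointSet Ψ)

/-- `(Ψ₁₁ + ⋯ + Ψ₁ₘ) ⋯ (Ψₙ₁ + ⋯ + Ψₙₘ)`, with pointwise sums and products of sets. -/
def forwardProd {n m : ℕ} (Ψ : Fin n → Fin m → Set (Op μ)) : Set (Op μ) :=
  (List.ofFn fun i => ∑ j, Ψ i j).prod

/-- `(Ψₙ₁ + ⋯ + Ψₙₘ) ⋯ (Ψ₁₁ + ⋯ + Ψ₁ₘ)`, with pointwise sums and products of sets. -/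
def backwardProd {n m : ℕ} (Ψ : Fin n → Fin m → Set (Op μ)) : Set (Op μ) :=
  (List.ofFn fun i => ∑ j, Ψ i j).reverse.prod

/-- The geometric mean of `ρ` of the forward product and `ρ` of the backward product. -/
def prodMean (ρ : Set (Op μ) → ℝ≥0∞) {n m : ℕ} (Ψ : Fin n → Fin m → Set (Op μ)) : ℝ≥0∞ :=
  ρ (forwardProd Ψ) ^ (1 / 2 : ℝ) * ρ (backwardProd Ψ) ^ (1 / 2 : ℝ)

end L2

end

end KernelOp

open KernelOp MeasureTheory

/-! Hölder's inequality shows that the operators under consideration are dominated by weighted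
geometric means in the sense of `Dominated`: `|T h| ≤ (A f) ^ α (B g) ^ (1 - α)` whenever
`|h| ≤ f ^ α g ^ (1 - α)`. This relation passes to sums and products, so no kernel of a product is
ever needed. An element of `S_α(Ψ)` is dominated by the mean of some `A ∈ Ψ` and some `B*`, `B ∈ Ψ`.
Since adjoints reverse products, the forward product of the symmetrizations is dominated by the
mean of the forward product of the original sets and the adjoint of their backward product, and
vice versa. If `ρ` of the dominated set is at most `ρ(Ψ₁) ^ α ρ(Ψ₂) ^ (1 - α)`, the weights cancel in
the geometric mean of the two products, which is the asserted inequality. Monotonicity follows,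
because `S_β(Ψ)` is contained in `S_t(S_α(Ψ))` for `β = α t + (1 - α) (1 - t)`, that is, for every `β`
between `α` and `1 - α` (`geomSymm_subset`).

For the norm and the numerical radius the estimate of a single dominated operator is Hölder's
inequality; for the spectral radius one applies Gelfand's formula to the powers. On a Hilbert space
the measure of non-compactness is the norm of the Calkin algebra (`enorm_calkin_coe`), so that the
essential spectral radius is obtained in the same way from the measure of non-compactness.

The estimate for the measure of non-compactness (`Dominated.hausdorffMeas_le`) uses a strictly
positive `w` in `L²`. A positive kernel operator maps the order interval `|g| ≤ w` to a totally
bounded set (`HasKernel.isAMCompact`): there it is approximated by the operators with kernels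
`min t (n w ⊗ w)`, which are compact by Bessel's inequality. Hence only the tails
`f 1_{|f| > M w}` of elements of the unit ball matter. As `M → ∞` these converge to `0` weakly,
uniformly in `f`, so that an operator `A` with measure of non-compactness less than `a` has norm at
most `a` on them (`eventually_enorm_apply_tail_le`), and domination applies pointwise. -/

namespace KernelOp

/-! ### The Hausdorff measure of non-compactness and the Calkin algebra -/

section Banach

variable {E : Type*} [NormedAddCommGroup E] [NormedSpace ℂ E]

theorem exists_finite_of_hausdorffMeas_lt {A : E →L[ℂ] E} {c : ℝ≥0∞}
    (h : hausdorffMeas A < c) :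
    ∃ δ : ℝ≥0, (δ : ℝ≥0∞) < c ∧ ∃ M : Set E, M.Finite ∧
      ∀ f : E, ‖f‖ ≤ 1 → ∃ m ∈ M, ‖A f - m‖ ≤ δ := by
  simp only [hausdorffMeas, iInf_lt_iff] at h
  obtain ⟨δ, -, ⟨M, hM, hsub⟩, hlt⟩ := h
  refine ⟨δ, hlt, M, hM, fun f hf => ?_⟩
  obtain ⟨m, hm, y, hy, hmy⟩ := hsub ⟨f, by simpa using hf, rfl⟩
  obtain ⟨z, hz, rfl⟩ := hy
  refine ⟨m, hm, ?_⟩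
  have hz' : ‖z‖ ≤ 1 := by simpa using hz
  have : A f - m = (δ : ℝ) • z := by rw [← hmy]; simp
  rw [this, norm_smul, Real.norm_eq_abs, abs_of_nonneg δ.coe_nonneg]
  exact mul_le_of_le_one_right δ.2 hz'

theorem hausdorffMeas_le_of_totallyBounded {A : E →L[ℂ] E} {δ : ℝ≥0} {S : Set E}
    (hS : TotallyBounded S) (h : ∀ f : E, ‖f‖ ≤ 1 → ∃ y ∈ S, ‖A f - y‖ ≤ δ) :
    hausdorffMeas A ≤ δ := by
  refine ENNReal.le_of_forall_pos_le_add fun ε hε _ => ?_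
  obtain ⟨M, hM, hcov⟩ := Metric.totallyBounded_iff.1 hS ε (by exact_mod_cast hε)
  have hpos : 0 < δ + ε := by positivity
  rw [← ENNReal.coe_add]
  refine iInf_le_of_le (δ + ε) (iInf_le_of_le hpos (iInf_le_of_le ⟨M, hM, ?_⟩ le_rfl))
  rintro _ ⟨f, hf, rfl⟩
  obtain ⟨y, hy, hfy⟩ := h f (by simpa using hf)
  obtain ⟨m, hm, hym⟩ := Set.mem_iUnion₂.1 (hcov hy)
  have hr : (0 : ℝ) < ((δ + ε : ℝ≥0) : ℝ) := by exact_mod_cast hpos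
  refine ⟨m, hm, A f - m, ⟨(((δ + ε : ℝ≥0) : ℝ))⁻¹ • (A f - m), ?_, ?_⟩, by simp⟩
  · have h1 : ‖A f - m‖ ≤ ((δ + ε : ℝ≥0) : ℝ) := by
      have h2 : ‖y - m‖ ≤ ε := by rw [← dist_eq_norm]; exact (Metric.mem_ball.1 hym).le
      calc ‖A f - m‖ ≤ ‖A f - y‖ + ‖y - m‖ := norm_sub_le_norm_sub_add_norm_sub _ _ _
        _ ≤ δ + ε := add_le_add hfy h2
        _ = _ := by push_cast; rfl
    rw [mem_closedBall_zero_iff, norm_smul, norm_inv, Real.norm_eq_abs, abs_of_pos hr]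
    exact (inv_mul_le_one₀ hr).2 h1
  · simp only [smul_smul]
    rw [mul_inv_cancel₀ hr.ne', one_smul]

theorem hausdorffMeas_le_enorm (A : E →L[ℂ] E) : hausdorffMeas A ≤ ‖A‖ₑ := by
  refine hausdorffMeas_le_of_totallyBounded (δ := ‖A‖₊) (S := {0})
    (Set.finite_singleton _).totallyBounded fun f hf => ⟨0, rfl, ?_⟩
  simpa using A.le_of_opNorm_le_of_le le_rfl hf

theorem hausdorffMeas_ne_top (A : E →L[ℂ] E) : hausdorffMeas A ≠ ∞ :=
  ((hausdorffMeas_le_enorm A).trans_lt enorm_lt_top).ne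

theorem hausdorffMeas_le_of_isCompactOperator {A K : E →L[ℂ] E} (hK : IsCompactOperator K)
    {δ : ℝ≥0} (h : ‖A - K‖ ≤ δ) : hausdorffMeas A ≤ δ := by
  have hK' : TotallyBounded (K '' Metric.closedBall 0 1) :=
    ((isCompactOperator_iff_isCompact_closure_image_closedBall (K : E →ₗ[ℂ] E)
      zero_lt_one).1 hK).totallyBounded.subset subset_closure
  refine hausdorffMeas_le_of_totallyBounded hK' fun f hf =>
    ⟨K f, ⟨f, by simpa using hf, rfl⟩, ?_⟩
  have := (A - K).le_of_opNorm_le_of_le h hf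
  simpa using this

theorem mem_compactIdeal {A : E →L[ℂ] E} : A ∈ compactIdeal E ↔ IsCompactOperator A :=
  TwoSidedIdeal.mem_mk' {T : E →L[ℂ] E | IsCompactOperator T} _ _ _ _ _ A

/-- The Calkin algebra as the quotient of a Banach space by a closed subspace. -/
noncomputable def calkinToQuotient (E : Type*) [NormedAddCommGroup E] [NormedSpace ℂ E] :
    Calkin E →ₗ[ℂ] (E →L[ℂ] E) ⧸ compactOperator (RingHom.id ℂ) E E where
  toFun := Quotient.lift (Submodule.mkQ _) fun x y hxy => by
    have h : IsCompactOperator (x - y) :=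
      mem_compactIdeal.1 ((TwoSidedIdeal.rel_iff _ x y).1 hxy)
    exact (Submodule.Quotient.eq _).2 h
  map_add' := by
    rintro ⟨x⟩ ⟨y⟩
    exact map_add (Submodule.mkQ _) x y
  map_smul' := by
    rintro c ⟨x⟩
    exact map_smul (Submodule.mkQ _) c x

theorem calkinToQuotient_injective : Function.Injective (calkinToQuotient E) := by
  rintro ⟨x⟩ ⟨y⟩ h
  have h' : IsCompactOperator (x - y) := (Submodule.Quotient.eq _).1 h
  refine Quotient.sound ((TwoSidedIdeal.rel_iff (compactIdeal E) x y).2 ?_)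
  exact mem_compactIdeal.2 h'

theorem calkinToQuotient_surjective : Function.Surjective (calkinToQuotient E) := by
  rintro ⟨x⟩
  exact ⟨(x : Calkin E), rfl⟩

theorem isClosed_compactOperator [CompleteSpace E] :
    IsClosed (compactOperator (RingHom.id ℂ) E E : Set (E →L[ℂ] E)) :=
  isClosed_setOfPred_isCompactOperator

theorem norm_compactOperator_mk_mul_le (x y : E →L[ℂ] E) :
    ‖(Submodule.Quotient.mk (x * y) : (E →L[ℂ] E) ⧸ compactOperator (RingHom.id ℂ) E E)‖
      ≤ ‖(Submodule.Quotient.mk x : (E →L[ℂ] E) ⧸ compactOperator (RingHom.id ℂ) E E)‖ *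
        ‖(Submodule.Quotient.mk y : (E →L[ℂ] E) ⧸ compactOperator (RingHom.id ℂ) E E)‖ := by
  refine le_of_forall_pos_le_add fun ε hε => ?_
  set a := ‖(Submodule.Quotient.mk x : (E →L[ℂ] E) ⧸ compactOperator (RingHom.id ℂ) E E)‖
  set b := ‖(Submodule.Quotient.mk y : (E →L[ℂ] E) ⧸ compactOperator (RingHom.id ℂ) E E)‖
  have ha : 0 ≤ a :=
    norm_nonneg (Submodule.Quotient.mk _ : (E →L[ℂ] E) ⧸ compactOperator (RingHom.id ℂ) E E)
  have hb : 0 ≤ b :=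
    norm_nonneg (Submodule.Quotient.mk _ : (E →L[ℂ] E) ⧸ compactOperator (RingHom.id ℂ) E E)
  -- `η` is chosen such that `(a + η) (b + η) ≤ a b + ε`
  set η := min 1 (ε / (a + b + 1))
  have hη : 0 < η := by positivity
  have hη1 : η ≤ 1 := min_le_left _ _
  have hη2 : η * (a + b + 1) ≤ ε := by
    rw [← le_div_iff₀ (by positivity)]; exact min_le_right _ _
  obtain ⟨x', hx', hxn⟩ := Submodule.Quotient.norm_mk_lt
    (Submodule.Quotient.mk x : (E →L[ℂ] E) ⧸ compactOperator (RingHom.id ℂ) E E) hη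
  obtain ⟨y', hy', hyn⟩ := Submodule.Quotient.norm_mk_lt
    (Submodule.Quotient.mk y : (E →L[ℂ] E) ⧸ compactOperator (RingHom.id ℂ) E E) hη
  have hxy : (Submodule.Quotient.mk (x * y) : (E →L[ℂ] E) ⧸ compactOperator (RingHom.id ℂ) E E)
      = Submodule.Quotient.mk (x' * y') := by
    refine (Submodule.Quotient.eq _).2 ?_
    have h1 : IsCompactOperator (x - x') :=
      (Submodule.Quotient.eq (compactOperator (RingHom.id ℂ) E E)).1 hx'.symm
    have h2 : IsCompactOperator (y - y') :=
      (Submodule.Quotient.eq (compactOperator (RingHom.id ℂ) E E)).1 hy'.symm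
    have h3 : x * y - x' * y' = x * (y - y') + (x - x') * y' := by noncomm_ring
    rw [h3]
    exact Submodule.add_mem _ (h2.clm_comp x) (h1.comp_clm y')
  rw [hxy]
  refine (Submodule.Quotient.norm_mk_le _ _).trans ((norm_mul_le x' y').trans ?_)
  calc ‖x'‖ * ‖y'‖ ≤ (a + η) * (b + η) := by gcongr
    _ = a * b + η * (a + b + η) := by ring
    _ ≤ a * b + η * (a + b + 1) := by gcongr
    _ ≤ _ := by gcongr

/-- The quotient norm on the Calkin algebra. -/
noncomputable abbrev calkinNormedAddCommGroup [CompleteSpace E] :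
    NormedAddCommGroup (Calkin E) :=
  haveI := isClosed_compactOperator (E := E)
  NormedAddCommGroup.induced (Calkin E) ((E →L[ℂ] E) ⧸ compactOperator (RingHom.id ℂ) E E)
    (calkinToQuotient E) calkinToQuotient_injective

/-- The Calkin algebra, with the quotient norm, as a normed ring. -/
noncomputable abbrev calkinNormedRing [CompleteSpace E] : NormedRing (Calkin E) :=
  { calkinNormedAddCommGroup (E := E), (inferInstance : Ring (Calkin E)) with
    norm_mul_le := by
      rintro ⟨x⟩ ⟨y⟩
      exact norm_compactOperator_mk_mul_le x y }

attribute [local instance] calkinNormedRing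

/-- The Calkin algebra, with the quotient norm, as a normed algebra. -/
noncomputable abbrev calkinNormedAlgebra [CompleteSpace E] : NormedAlgebra ℂ (Calkin E) where
  toAlgebra := inferInstance
  norm_smul_le r x := by
    change ‖calkinToQuotient E (r • x)‖ ≤ ‖r‖ * ‖calkinToQuotient E x‖
    rw [map_smul]
    exact norm_smul_le r (calkinToQuotient E x)

attribute [local instance] calkinNormedAlgebra

theorem calkin_completeSpace [CompleteSpace E] : CompleteSpace (Calkin E) := by
  have := isClosed_compactOperator (E := E)
  have hi : Isometry (calkinToQuotient E) :=
    AddMonoidHomClass.isometry_of_norm (calkinToQuotient E) fun x => rfl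
  refine (hi.isUniformInducing.completeSpace_congr ?_).2 inferInstance
  exact calkinToQuotient_surjective

end Banach

/-! ### Essential norm and spectral radii on a Hilbert space -/

section Hilbert

open Filter Topology

variable {H : Type*} [NormedAddCommGroup H] [InnerProductSpace ℂ H]

theorem isCompactOperator_starProjection (V : Submodule ℂ H) [FiniteDimensional ℂ V] :
    IsCompactOperator V.starProjection := by
  have : ProperSpace V := FiniteDimensional.proper ℂ V
  have h : IsCompactOperator V.orthogonalProjectionOnto :=
    isCompactOperator_of_locallyCompactSpace_dom V.orthogonalProjectionOnto
  exact h.clm_comp V.subtypeL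

theorem norm_sub_starProjection_le (V : Submodule ℂ H) [V.HasOrthogonalProjection] (y : H) {m : H}
    (hm : m ∈ V) : ‖y - V.starProjection y‖ ≤ ‖y - m‖ := by
  rw [Submodule.starProjection_minimal]
  exact ciInf_le ⟨0, by rintro _ ⟨x, rfl⟩; exact norm_nonneg _⟩ (⟨m, hm⟩ : V)

theorem exists_norm_sub_starProjection_comp_le {A : H →L[ℂ] H} {c : ℝ≥0∞}
    (h : hausdorffMeas A < c) :
    ∃ δ : ℝ≥0, (δ : ℝ≥0∞) < c ∧ ∃ V : Submodule ℂ H, ∃ _ : FiniteDimensional ℂ V,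
      ‖A - V.starProjection * A‖ ≤ δ := by
  obtain ⟨δ, hδ, M, hM, hA⟩ := exists_finite_of_hausdorffMeas_lt h
  have hV : FiniteDimensional ℂ (Submodule.span ℂ M) := FiniteDimensional.span_of_finite ℂ hM
  refine ⟨δ, hδ, Submodule.span ℂ M, hV, ContinuousLinearMap.opNorm_le_of_unit_norm δ.2 ?_⟩
  intro f hf
  obtain ⟨m, hm, hfm⟩ := hA f hf.le
  exact (norm_sub_starProjection_le _ _ (Submodule.subset_span hm)).trans hfm

theorem enorm_pow_rpow_le (A : H →L[ℂ] H) {k : ℕ} (hk : k ≠ 0) :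
    ‖A ^ k‖ₑ ^ (1 / k : ℝ) ≤ ‖A‖ₑ := by
  have h1 : ‖A ^ k‖ₑ ≤ ‖A‖ₑ ^ k := by
    have := norm_pow_le' A (Nat.pos_of_ne_zero hk)
    simp only [enorm_eq_nnnorm]
    exact_mod_cast this
  calc ‖A ^ k‖ₑ ^ (1 / k : ℝ) ≤ (‖A‖ₑ ^ k) ^ (1 / k : ℝ) := by gcongr
    _ = ‖A‖ₑ := by
      rw [one_div]; exact ENNReal.pow_rpow_inv_natCast hk _

theorem numRadius_le_enorm (A : H →L[ℂ] H) : numRadius A ≤ ‖A‖ₑ := by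
  refine iSup₂_le fun f hf => ?_
  have : ‖inner ℂ (A f) f‖ ≤ ‖A‖ := by
    refine (norm_inner_le_norm _ _).trans ?_
    rw [hf, mul_one]
    exact A.unit_le_opNorm f hf.le
  simp only [enorm_eq_nnnorm]
  exact_mod_cast this

variable [CompleteSpace H]

theorem hausdorffMeas_adjoint_le (A : H →L[ℂ] H) :
    hausdorffMeas (ContinuousLinearMap.adjoint A) ≤ hausdorffMeas A := by
  refine le_of_forall_gt fun c hc => ?_
  obtain ⟨δ, hδ, V, hV, hA⟩ := exists_norm_sub_starProjection_comp_le hc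
  have hP : ContinuousLinearMap.adjoint V.starProjection = V.starProjection :=
    (isSelfAdjoint_starProjection V).star_eq
  have hK : IsCompactOperator (ContinuousLinearMap.adjoint A * V.starProjection) :=
    (isCompactOperator_starProjection V).clm_comp (ContinuousLinearMap.adjoint A)
  refine (hausdorffMeas_le_of_isCompactOperator hK (δ := δ) ?_).trans_lt hδ
  have h1 : ContinuousLinearMap.adjoint A - ContinuousLinearMap.adjoint A * V.starProjection =
      ContinuousLinearMap.adjoint (A - V.starProjection * A) := by
    rw [map_sub, ContinuousLinearMap.mul_def, ContinuousLinearMap.mul_def,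
      ContinuousLinearMap.adjoint_comp, hP]
  rw [h1, LinearIsometryEquiv.norm_map]
  exact hA

theorem hausdorffMeas_adjoint (A : H →L[ℂ] H) :
    hausdorffMeas (ContinuousLinearMap.adjoint A) = hausdorffMeas A := by
  refine le_antisymm (hausdorffMeas_adjoint_le A) ?_
  simpa using hausdorffMeas_adjoint_le (ContinuousLinearMap.adjoint A)

attribute [local instance] calkinNormedRing calkinNormedAlgebra

/-- On a Hilbert space the Hausdorff measure of non-compactness is the norm in the Calkin
algebra: an operator that maps the unit ball into a `δ`-neighbourhood of a finite set `M` is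
`δ`-close to its compression by the projection onto the span of `M`. -/
theorem enorm_calkin_coe (A : H →L[ℂ] H) : ‖(A : Calkin H)‖ₑ = hausdorffMeas A := by
  have hn : ∀ K : H →L[ℂ] H, IsCompactOperator K → ‖(A : Calkin H)‖ ≤ ‖A - K‖ := by
    intro K hK
    have h1 : (Submodule.Quotient.mk A : (H →L[ℂ] H) ⧸ compactOperator (RingHom.id ℂ) H H) =
        Submodule.Quotient.mk (A - K) := by
      refine (Submodule.Quotient.eq _).2 ?_
      rw [sub_sub_cancel]; exact hK
    change ‖(Submodule.Quotient.mk A : (H →L[ℂ] H) ⧸ compactOperator (RingHom.id ℂ) H H)‖ ≤ _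
    rw [h1]
    exact Submodule.Quotient.norm_mk_le _ _
  refine le_antisymm (le_of_forall_gt fun c hc => ?_) (le_of_forall_gt fun c hc => ?_)
  · obtain ⟨δ, hδ, V, hV, hA⟩ := exists_norm_sub_starProjection_comp_le hc
    refine lt_of_le_of_lt ?_ hδ
    have := (hn _ ((isCompactOperator_starProjection V).comp_clm A)).trans hA
    rw [enorm_eq_nnnorm]
    exact_mod_cast this
  · obtain ⟨c', h1, h2⟩ := ENNReal.lt_iff_exists_nnreal_btwn.1 hc
    have h1' : ‖(A : Calkin H)‖ < c' := by
      rw [enorm_eq_nnnorm] at h1; exact_mod_cast h1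
    obtain ⟨B, hB, hBn⟩ := Submodule.Quotient.norm_mk_lt
      (Submodule.Quotient.mk A : (H →L[ℂ] H) ⧸ compactOperator (RingHom.id ℂ) H H)
      (sub_pos.2 h1')
    have h3 : IsCompactOperator (A - B) :=
      (Submodule.Quotient.eq (compactOperator (RingHom.id ℂ) H H)).1 hB.symm
    refine lt_of_le_of_lt (hausdorffMeas_le_of_isCompactOperator h3 (δ := c') ?_) h2
    rw [sub_sub_cancel]
    refine hBn.le.trans ?_
    change ‖(A : Calkin H)‖ + _ ≤ _
    simp

theorem tendsto_hausdorffMeas_pow_essRadius (A : H →L[ℂ] H) :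
    Tendsto (fun k : ℕ => hausdorffMeas (A ^ k) ^ (1 / k : ℝ)) atTop (𝓝 (essRadius A)) := by
  have := calkin_completeSpace (E := H)
  have h := spectrum.pow_nnnorm_pow_one_div_tendsto_nhds_spectralRadius (A : Calkin H)
  refine h.congr fun k => ?_
  rw [← enorm_eq_nnnorm, ← RingCon.coe_pow, enorm_calkin_coe]

theorem tendsto_enorm_pow_spectralRadius (A : H →L[ℂ] H) :
    Tendsto (fun k : ℕ => ‖A ^ k‖ₑ ^ (1 / k : ℝ)) atTop (𝓝 (spectralRadius ℂ A)) :=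
  spectrum.pow_nnnorm_pow_one_div_tendsto_nhds_spectralRadius A

theorem adjoint_pow (A : H →L[ℂ] H) (k : ℕ) :
    ContinuousLinearMap.adjoint A ^ k = ContinuousLinearMap.adjoint (A ^ k) :=
  (star_pow A k).symm

theorem enorm_adjoint (A : H →L[ℂ] H) : ‖ContinuousLinearMap.adjoint A‖ₑ = ‖A‖ₑ := by
  simp [enorm_eq_nnnorm]

theorem spectralRadius_adjoint (A : H →L[ℂ] H) :
    spectralRadius ℂ (ContinuousLinearMap.adjoint A) = spectralRadius ℂ A := by
  refine tendsto_nhds_unique (tendsto_enorm_pow_spectralRadius _) ?_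
  simpa only [adjoint_pow, enorm_adjoint] using tendsto_enorm_pow_spectralRadius A

theorem essRadius_adjoint (A : H →L[ℂ] H) :
    essRadius (ContinuousLinearMap.adjoint A) = essRadius A := by
  refine tendsto_nhds_unique (tendsto_hausdorffMeas_pow_essRadius _) ?_
  simpa only [adjoint_pow, hausdorffMeas_adjoint] using tendsto_hausdorffMeas_pow_essRadius A

theorem numRadius_adjoint (A : H →L[ℂ] H) :
    numRadius (ContinuousLinearMap.adjoint A) = numRadius A := by
  unfold numRadius
  refine iSup_congr fun f => iSup_congr fun _ => ?_
  rw [ContinuousLinearMap.adjoint_inner_left, ← inner_conj_symm, RCLike.enorm_conj]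

theorem spectralRadius_le_enorm (A : H →L[ℂ] H) : spectralRadius ℂ A ≤ ‖A‖ₑ :=
  le_of_tendsto (tendsto_enorm_pow_spectralRadius A)
    ((eventually_ne_atTop 0).mono fun _ hk => enorm_pow_rpow_le A hk)

theorem essRadius_le_enorm (A : H →L[ℂ] H) : essRadius A ≤ ‖A‖ₑ :=
  le_of_tendsto (tendsto_hausdorffMeas_pow_essRadius A)
    ((eventually_ne_atTop 0).mono fun _ hk =>
      (ENNReal.rpow_le_rpow (hausdorffMeas_le_enorm _) (by positivity)).trans
        (enorm_pow_rpow_le A hk))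

/-- An operator of Hilbert–Schmidt type is compact. If the orthonormal family `v` nearly
attains the supremum of `∑ i, ‖T (v i)‖ ^ 2`, then `T` is small on the orthogonal complement
of the span of `v`. -/
theorem isCompactOperator_of_sum_sq_le (T : H →L[ℂ] H) (C : ℝ)
    (hT : ∀ (n : ℕ) (v : Fin n → H), Orthonormal ℂ v → ∑ i, ‖T (v i)‖ ^ 2 ≤ C) :
    IsCompactOperator T := by
  refine isClosed_setOfPred_isCompactOperator.closure_subset (Metric.mem_closure_iff.2 ?_)
  intro ε hε
  let S : Set ℝ := {r | ∃ (n : ℕ) (v : Fin n → H), Orthonormal ℂ v ∧ r = ∑ i, ‖T (v i)‖ ^ 2}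
  have hSne : S.Nonempty := ⟨_, 0, Fin.elim0, ⟨fun i => i.elim0, fun i => i.elim0⟩, rfl⟩
  have hSb : BddAbove S := ⟨C, by rintro _ ⟨n, v, hv, rfl⟩; exact hT n v hv⟩
  obtain ⟨_, ⟨n, v, hv, rfl⟩, hlt⟩ :=
    exists_lt_of_lt_csSup hSne (sub_lt_self (sSup S) (by positivity : 0 < (ε / 2) ^ 2))
  have hfin : FiniteDimensional ℂ (Submodule.span ℂ (Set.range v)) :=
    FiniteDimensional.span_of_finite ℂ (Set.finite_range v)
  set V := Submodule.span ℂ (Set.range v) with hV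
  have hunit : ∀ e ∈ Vᗮ, ‖e‖ = 1 → ‖T e‖ ≤ ε / 2 := by
    intro e he hen
    have hcons : Orthonormal ℂ (Fin.cons e v : Fin (n + 1) → H) := by
      exact orthonormal_vecCons_iff.2 ⟨hen, fun i => (Submodule.mem_orthogonal' V e).1 he _
        (Submodule.subset_span ⟨i, rfl⟩), hv⟩
    have h1 := le_csSup hSb ⟨n + 1, _, hcons, rfl⟩
    rw [Fin.sum_univ_succ] at h1
    simp only [Fin.cons_zero, Fin.cons_succ] at h1
    have : ‖T e‖ ^ 2 ≤ (ε / 2) ^ 2 := by linarith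
    exact (pow_le_pow_iff_left₀ (norm_nonneg _) (by positivity) two_ne_zero).1 this
  have hall : ∀ e ∈ Vᗮ, ‖T e‖ ≤ ε / 2 * ‖e‖ := by
    intro e he
    by_cases h0 : e = 0
    · simp [h0]
    have hne : ‖e‖ ≠ 0 := norm_ne_zero_iff.2 h0
    have := hunit (((‖e‖⁻¹ : ℝ) : ℂ) • e) (Vᗮ.smul_mem _ he) (by
      rw [norm_smul]; simp [hne])
    rw [map_smul, norm_smul] at this
    simp only [Complex.ofReal_inv, norm_inv, Complex.norm_real, norm_norm] at this
    rwa [inv_mul_le_iff₀ (by positivity), mul_comm] at this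
  refine ⟨T * V.starProjection, (isCompactOperator_starProjection V).clm_comp T, ?_⟩
  rw [dist_eq_norm]
  refine lt_of_le_of_lt ?_ (half_lt_self hε)
  refine ContinuousLinearMap.opNorm_le_of_unit_norm (by positivity) fun f hf => ?_
  have h1 : (T - T * V.starProjection) f = T (f - V.starProjection f) := by simp
  rw [h1]
  refine (hall _ (V.sub_starProjection_mem_orthogonal f)).trans ?_
  have h2 : ‖f - V.starProjection f‖ ≤ 1 := by
    simpa [hf] using norm_sub_starProjection_le V f V.zero_mem
  nlinarith [norm_nonneg (f - V.starProjection f)]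

end Hilbert

/-! ### Domination by a weighted geometric mean -/

section L2

open MeasureTheory Filter Topology

variable {X : Type*} [MeasurableSpace X] {μ : Measure X}

theorem enorm_complex_ofNNReal (r : ℝ≥0) : ‖((r : ℝ) : ℂ)‖ₑ = r := by
  rw [← ofReal_norm, Complex.norm_real, ofReal_norm, enorm_eq_nnnorm]
  simp

theorem enorm_complex_ofReal_norm (z : ℂ) : ‖((‖z‖ : ℝ) : ℂ)‖ₑ = ‖z‖ₑ :=
  enorm_complex_ofNNReal ‖z‖₊

/-- A nonnegative element of `L²`: it agrees with its modulus almost everywhere. -/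
def NonnegAE (f : Lp ℂ 2 μ) : Prop := ∀ᵐ x ∂μ, f x = ((‖f x‖ : ℝ) : ℂ)

/-- The modulus of an element of `L²`. -/
noncomputable def absLp (f : Lp ℂ 2 μ) : Lp ℂ 2 μ :=
  MemLp.toLp (fun x => ((‖f x‖ : ℝ) : ℂ)) (Lp.memLp f).norm.ofReal

theorem coeFn_absLp (f : Lp ℂ 2 μ) : ∀ᵐ x ∂μ, absLp f x = ((‖f x‖ : ℝ) : ℂ) :=
  MemLp.coeFn_toLp _

theorem enorm_coeFn_absLp (f : Lp ℂ 2 μ) : ∀ᵐ x ∂μ, ‖absLp f x‖ₑ = ‖f x‖ₑ := by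
  filter_upwards [coeFn_absLp f] with x hx
  rw [hx, enorm_complex_ofReal_norm]

theorem nonnegAE_absLp (f : Lp ℂ 2 μ) : NonnegAE (absLp f) := by
  filter_upwards [coeFn_absLp f] with x hx
  rw [hx, Complex.norm_real, norm_norm]

theorem NonnegAE.add {f g : Lp ℂ 2 μ} (hf : NonnegAE f) (hg : NonnegAE g) :
    NonnegAE (f + g) := by
  filter_upwards [hf, hg, Lp.coeFn_add f g] with x h1 h2 h3
  rw [h3, Pi.add_apply, h1, h2, ← Complex.ofReal_add, Complex.norm_real, Real.norm_eq_abs,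
    abs_of_nonneg (by positivity)]

theorem nonnegAE_zero : NonnegAE (0 : Lp ℂ 2 μ) := by
  filter_upwards [Lp.coeFn_zero ℂ 2 μ] with x h1
  rw [h1, Pi.zero_apply, norm_zero, Complex.ofReal_zero]

theorem NonnegAE.enorm_add {f g : Lp ℂ 2 μ} (hf : NonnegAE f) (hg : NonnegAE g) :
    ∀ᵐ x ∂μ, ‖(f + g) x‖ₑ = ‖f x‖ₑ + ‖g x‖ₑ := by
  filter_upwards [hf, hg, Lp.coeFn_add f g] with x h1 h2 h3
  have h4 : (f + g) x = (((‖f x‖₊ + ‖g x‖₊ : ℝ≥0) : ℝ) : ℂ) := by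
    rw [h3, Pi.add_apply, NNReal.coe_add, Complex.ofReal_add, coe_nnnorm, coe_nnnorm, ← h1, ← h2]
  rw [h4, enorm_complex_ofNNReal, ENNReal.coe_add, enorm_eq_nnnorm, enorm_eq_nnnorm]

theorem enorm_sq_eq_lintegral (f : Lp ℂ 2 μ) :
    ‖f‖ₑ ^ (2 : ℝ) = ∫⁻ x, ‖f x‖ₑ ^ (2 : ℝ) ∂μ := by
  rw [Lp.enorm_def]
  exact eLpNorm_nnreal_pow_eq_lintegral (f := f) (μ := μ) (p := 2) two_ne_zero

theorem enorm_le_of_ae_enorm_le {f g : Lp ℂ 2 μ} (h : ∀ᵐ x ∂μ, ‖f x‖ₑ ≤ ‖g x‖ₑ) :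
    ‖f‖ₑ ≤ ‖g‖ₑ := by
  rw [Lp.enorm_def, Lp.enorm_def]
  exact eLpNorm_mono_enorm_ae h

theorem enorm_absLp (f : Lp ℂ 2 μ) : ‖absLp f‖ₑ = ‖f‖ₑ :=
  le_antisymm (enorm_le_of_ae_enorm_le ((enorm_coeFn_absLp f).mono fun _ h => h.le))
    (enorm_le_of_ae_enorm_le ((enorm_coeFn_absLp f).mono fun _ h => h.ge))

theorem enorm_inner_le_lintegral (f g : Lp ℂ 2 μ) :
    ‖inner ℂ f g‖ₑ ≤ ∫⁻ x, ‖f x‖ₑ * ‖g x‖ₑ ∂μ := by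
  rw [L2.inner_def]
  refine (enorm_integral_le_lintegral_enorm _).trans (lintegral_mono fun x => ?_)
  simp [enorm_mul, mul_comm]

theorem NonnegAE.enorm_inner {f g : Lp ℂ 2 μ} (hf : NonnegAE f) (hg : NonnegAE g) :
    ‖inner ℂ f g‖ₑ = ∫⁻ x, ‖f x‖ₑ * ‖g x‖ₑ ∂μ := by
  have h1 : inner ℂ f g = ((∫ x, ‖f x‖ * ‖g x‖ ∂μ : ℝ) : ℂ) := by
    rw [L2.inner_def, ← integral_complex_ofReal]
    refine integral_congr_ae ?_
    filter_upwards [hf, hg] with x h1 h2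
    rw [h1, h2]
    simp [mul_comm]
  have hi : Integrable (fun x => ‖f x‖ * ‖g x‖) μ :=
    (Lp.memLp f).norm.integrable_mul (Lp.memLp g).norm
  have h2 : 0 ≤ ∫ x, ‖f x‖ * ‖g x‖ ∂μ := integral_nonneg fun x => by positivity
  rw [h1, ← ofReal_norm, Complex.norm_real, Real.norm_eq_abs, abs_of_nonneg h2,
    ofReal_integral_eq_lintegral_ofReal hi (.of_forall fun x => by positivity)]
  refine lintegral_congr fun x => ?_
  rw [ENNReal.ofReal_mul (norm_nonneg _), ofReal_norm, ofReal_norm]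

theorem aemeasurable_enorm (f : Lp ℂ 2 μ) : AEMeasurable (fun x => ‖f x‖ₑ) μ :=
  (Lp.aestronglyMeasurable f).enorm

/-- Hölder's inequality for the weights `α`, `1 - α`, for sums of two terms. -/
theorem rpow_mul_rpow_add_le {α : ℝ} (h0 : 0 ≤ α) (h1 : α ≤ 1) (a b c d : ℝ≥0∞) :
    a ^ α * b ^ (1 - α) + c ^ α * d ^ (1 - α) ≤ (a + c) ^ α * (b + d) ^ (1 - α) := by
  have := ENNReal.lintegral_mul_norm_pow_le (μ := (Measure.count : Measure Bool))
    (f := fun i => cond i a c) (g := fun i => cond i b d) (measurable_of_finite _).aemeasurable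
    (measurable_of_finite _).aemeasurable h0 (sub_nonneg.2 h1) (add_sub_cancel _ _)
  simpa [lintegral_count, tsum_fintype] using this

theorem ennreal_rpow_comm (a : ℝ≥0∞) (s t : ℝ) : (a ^ s) ^ t = (a ^ t) ^ s := by
  rw [← ENNReal.rpow_mul, mul_comm, ENNReal.rpow_mul]

theorem enorm_le_rpow_mul_rpow {α : ℝ} (h0 : 0 ≤ α) (h1 : α ≤ 1) {f g h : Lp ℂ 2 μ}
    (hh : ∀ᵐ x ∂μ, ‖h x‖ₑ ≤ ‖f x‖ₑ ^ α * ‖g x‖ₑ ^ (1 - α)) :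
    ‖h‖ₑ ≤ ‖f‖ₑ ^ α * ‖g‖ₑ ^ (1 - α) := by
  rw [← ENNReal.rpow_le_rpow_iff two_pos, ENNReal.mul_rpow_of_nonneg _ _ zero_le_two,
    ennreal_rpow_comm, ennreal_rpow_comm ‖g‖ₑ]
  simp only [enorm_sq_eq_lintegral]
  refine le_trans (lintegral_mono_ae ?_) (ENNReal.lintegral_mul_norm_pow_le
    ((aemeasurable_enorm f).pow_const _) ((aemeasurable_enorm g).pow_const _)
    h0 (sub_nonneg.2 h1) (add_sub_cancel _ _))
  filter_upwards [hh] with x hx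
  rw [ennreal_rpow_comm, ennreal_rpow_comm ‖g x‖ₑ,
    ← ENNReal.mul_rpow_of_nonneg _ _ zero_le_two]
  gcongr

/-- `T` is dominated by the weighted geometric mean of the positive operators `A` and `B`:
`|T h| ≤ (A f) ^ α (B g) ^ (1 - α)` whenever `|h| ≤ f ^ α g ^ (1 - α)` and `f, g ≥ 0`. -/
structure Dominated (α : ℝ) (T A B : Op μ) : Prop where
  nonneg_left : ∀ f, NonnegAE f → NonnegAE (A f)
  nonneg_right : ∀ f, NonnegAE f → NonnegAE (B f)
  enorm_le : ∀ f g h : Lp ℂ 2 μ, NonnegAE f → NonnegAE g →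
    (∀ᵐ x ∂μ, ‖h x‖ₑ ≤ ‖f x‖ₑ ^ α * ‖g x‖ₑ ^ (1 - α)) →
      ∀ᵐ x ∂μ, ‖T h x‖ₑ ≤ ‖A f x‖ₑ ^ α * ‖B g x‖ₑ ^ (1 - α)

theorem dominated_one (α : ℝ) : Dominated α (1 : Op μ) 1 1 where
  nonneg_left _ hf := hf
  nonneg_right _ hf := hf
  enorm_le _ _ _ _ _ hh := hh

theorem dominated_zero (α : ℝ) : Dominated α (0 : Op μ) 0 0 where
  nonneg_left _ _ := nonnegAE_zero
  nonneg_right _ _ := nonnegAE_zero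
  enorm_le _ _ _ _ _ _ := by
    filter_upwards [Lp.coeFn_zero ℂ 2 μ] with x h1
    rw [_root_.zero_apply, h1, Pi.zero_apply, enorm_zero]
    exact zero_le

theorem Dominated.mul {α : ℝ} {T A B T' A' B' : Op μ} (h : Dominated α T A B)
    (h' : Dominated α T' A' B') : Dominated α (T * T') (A * A') (B * B') where
  nonneg_left f hf := h.nonneg_left _ (h'.nonneg_left f hf)
  nonneg_right f hf := h.nonneg_right _ (h'.nonneg_right f hf)
  enorm_le f g k hf hg hk := h.enorm_le _ _ _ (h'.nonneg_left f hf) (h'.nonneg_right g hg)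
    (h'.enorm_le f g k hf hg hk)

theorem Dominated.pow {α : ℝ} {T A B : Op μ} (h : Dominated α T A B) (k : ℕ) :
    Dominated α (T ^ k) (A ^ k) (B ^ k) := by
  induction k with
  | zero => simpa using dominated_one α
  | succ k ih => simpa only [pow_succ] using ih.mul h

theorem Dominated.add {α : ℝ} (h0 : 0 ≤ α) (h1 : α ≤ 1) {T A B T' A' B' : Op μ}
    (h : Dominated α T A B) (h' : Dominated α T' A' B') :
    Dominated α (T + T') (A + A') (B + B') where
  nonneg_left f hf := (h.nonneg_left f hf).add (h'.nonneg_left f hf)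
  nonneg_right f hf := (h.nonneg_right f hf).add (h'.nonneg_right f hf)
  enorm_le f g k hf hg hk := by
    filter_upwards [h.enorm_le f g k hf hg hk, h'.enorm_le f g k hf hg hk,
      (h.nonneg_left f hf).enorm_add (h'.nonneg_left f hf),
      (h.nonneg_right g hg).enorm_add (h'.nonneg_right g hg),
      Lp.coeFn_add (T k) (T' k)] with x e1 e2 e3 e4 e5
    simp only [_root_.add_apply] at *
    rw [e5, e3, e4, Pi.add_apply]
    exact (enorm_add_le _ _).trans ((add_le_add e1 e2).trans (rpow_mul_rpow_add_le h0 h1 _ _ _ _))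

theorem rpow_mul_rpow_one_sub {α : ℝ} (h0 : 0 ≤ α) (h1 : α ≤ 1) (a : ℝ≥0∞) :
    a ^ α * a ^ (1 - α) = a := by
  rw [← ENNReal.rpow_add_of_nonneg _ _ h0 (sub_nonneg.2 h1), add_sub_cancel, ENNReal.rpow_one]

theorem Dominated.enorm_apply_le {α : ℝ} (h0 : 0 ≤ α) (h1 : α ≤ 1) {T A B : Op μ}
    (h : Dominated α T A B) (f : Lp ℂ 2 μ) :
    ∀ᵐ x ∂μ, ‖T f x‖ₑ ≤ ‖A (absLp f) x‖ₑ ^ α * ‖B (absLp f) x‖ₑ ^ (1 - α) := by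
  refine h.enorm_le _ _ _ (nonnegAE_absLp f) (nonnegAE_absLp f) ?_
  filter_upwards [enorm_coeFn_absLp f] with x hx
  rw [hx, rpow_mul_rpow_one_sub h0 h1]

theorem Dominated.enorm_le_rpow {α : ℝ} (h0 : 0 ≤ α) (h1 : α ≤ 1) {T A B : Op μ}
    (h : Dominated α T A B) : ‖T‖ₑ ≤ ‖A‖ₑ ^ α * ‖B‖ₑ ^ (1 - α) := by
  have key : ∀ f : Lp ℂ 2 μ, ‖T f‖ₑ ≤ ‖A‖ₑ ^ α * ‖B‖ₑ ^ (1 - α) * ‖f‖ₑ := fun f => by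
    calc ‖T f‖ₑ ≤ ‖A (absLp f)‖ₑ ^ α * ‖B (absLp f)‖ₑ ^ (1 - α) :=
          enorm_le_rpow_mul_rpow h0 h1 (h.enorm_apply_le h0 h1 f)
      _ ≤ (‖A‖ₑ * ‖f‖ₑ) ^ α * (‖B‖ₑ * ‖f‖ₑ) ^ (1 - α) := by
          have := sub_nonneg.2 h1
          gcongr
          · exact (A.le_opENorm _).trans_eq (by rw [enorm_absLp])
          · exact (B.le_opENorm _).trans_eq (by rw [enorm_absLp])
      _ = ‖A‖ₑ ^ α * ‖B‖ₑ ^ (1 - α) * (‖f‖ₑ ^ α * ‖f‖ₑ ^ (1 - α)) := by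
          rw [ENNReal.mul_rpow_of_nonneg _ _ h0, ENNReal.mul_rpow_of_nonneg _ _ (sub_nonneg.2 h1)]
          ring
      _ = _ := by rw [rpow_mul_rpow_one_sub h0 h1]
  exact T.opENorm_le_bound key

theorem Dominated.spectralRadius_le {α : ℝ} (h0 : 0 ≤ α) (h1 : α ≤ 1) {T A B : Op μ}
    (h : Dominated α T A B) :
    spectralRadius ℂ T ≤ spectralRadius ℂ A ^ α * spectralRadius ℂ B ^ (1 - α) := by
  have hA := tendsto_enorm_pow_spectralRadius A
  have hB := tendsto_enorm_pow_spectralRadius B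
  have h1' := sub_nonneg.2 h1
  have hAf : spectralRadius ℂ A ^ α ≠ ∞ := ENNReal.rpow_ne_top_of_nonneg h0
    ((spectralRadius_le_enorm A).trans_lt enorm_lt_top).ne
  have hBf : spectralRadius ℂ B ^ (1 - α) ≠ ∞ := ENNReal.rpow_ne_top_of_nonneg h1'
    ((spectralRadius_le_enorm B).trans_lt enorm_lt_top).ne
  refine le_of_tendsto_of_tendsto' (tendsto_enorm_pow_spectralRadius T)
    (ENNReal.Tendsto.mul ((ENNReal.continuous_rpow_const.tendsto _).comp hA) (.inr hBf)
      ((ENNReal.continuous_rpow_const.tendsto _).comp hB) (.inr hAf)) fun k => ?_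
  have hk : (0 : ℝ) ≤ 1 / k := by positivity
  refine (ENNReal.rpow_le_rpow ((h.pow k).enorm_le_rpow h0 h1) hk).trans_eq ?_
  rw [ENNReal.mul_rpow_of_nonneg _ _ hk, Function.comp, Function.comp, ennreal_rpow_comm,
    ennreal_rpow_comm ‖B ^ k‖ₑ]

theorem Dominated.numRadius_le {α : ℝ} (h0 : 0 ≤ α) (h1 : α ≤ 1) {T A B : Op μ}
    (h : Dominated α T A B) : numRadius T ≤ numRadius A ^ α * numRadius B ^ (1 - α) := by
  refine iSup₂_le fun f hf => ?_
  have hf' : ‖absLp f‖ = 1 := by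
    have := congrArg ENNReal.toReal (enorm_absLp f)
    simpa [hf] using this
  have hA : ∫⁻ x, ‖A (absLp f) x‖ₑ * ‖absLp f x‖ₑ ∂μ ≤ numRadius A := by
    rw [← (h.nonneg_left _ (nonnegAE_absLp f)).enorm_inner (nonnegAE_absLp f)]
    exact le_iSup₂_of_le (absLp f) hf' le_rfl
  have hB : ∫⁻ x, ‖B (absLp f) x‖ₑ * ‖absLp f x‖ₑ ∂μ ≤ numRadius B := by
    rw [← (h.nonneg_right _ (nonnegAE_absLp f)).enorm_inner (nonnegAE_absLp f)]
    exact le_iSup₂_of_le (absLp f) hf' le_rfl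
  have h1' := sub_nonneg.2 h1
  refine (enorm_inner_le_lintegral _ _).trans (le_trans ?_ (mul_le_mul'
    (ENNReal.rpow_le_rpow hA h0) (ENNReal.rpow_le_rpow hB h1')))
  refine le_trans (lintegral_mono_ae ?_) (ENNReal.lintegral_mul_norm_pow_le
    ((aemeasurable_enorm _).mul (aemeasurable_enorm _))
    ((aemeasurable_enorm _).mul (aemeasurable_enorm _)) h0 h1' (add_sub_cancel _ _))
  filter_upwards [h.enorm_apply_le h0 h1 f, enorm_coeFn_absLp f] with x e1 e2
  simp only [Pi.mul_apply, e2]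
  rw [ENNReal.mul_rpow_of_nonneg _ _ h0,
    ENNReal.mul_rpow_of_nonneg _ _ h1']
  calc ‖T f x‖ₑ * ‖f x‖ₑ
      ≤ ‖A (absLp f) x‖ₑ ^ α * ‖B (absLp f) x‖ₑ ^ (1 - α) * ‖f x‖ₑ := by gcongr
    _ = ‖A (absLp f) x‖ₑ ^ α * ‖B (absLp f) x‖ₑ ^ (1 - α) *
        (‖f x‖ₑ ^ α * ‖f x‖ₑ ^ (1 - α)) := by rw [rpow_mul_rpow_one_sub h0 h1]
    _ = _ := by ring

/-! ### Order bounded sets and the measure of non-compactness -/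

/-- A strictly positive square-integrable function; it is an order unit of an ideal that is
dense in `L²`. -/
structure IsWeight (w : X → ℝ≥0) (μ : Measure X) : Prop where
  measurable : Measurable w
  pos : ∀ x, 0 < w x
  lintegral_sq_lt_top : ∫⁻ x, (w x : ℝ≥0∞) ^ (2 : ℝ) ∂μ < ∞

theorem exists_isWeight (μ : Measure X) [SigmaFinite μ] : ∃ w : X → ℝ≥0, IsWeight w μ := by
  obtain ⟨g, hpos, hm, hlt⟩ := exists_pos_lintegral_lt_of_sigmaFinite μ one_ne_zero
  refine ⟨fun x => NNReal.sqrt (g x), NNReal.continuous_sqrt.measurable.comp hm,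
    fun x => NNReal.sqrt_pos.2 (hpos x), ?_⟩
  refine lt_of_le_of_lt (lintegral_mono fun x => ?_) (hlt.trans ENNReal.one_lt_top)
  rw [← ENNReal.coe_rpow_of_nonneg _ zero_le_two, ENNReal.coe_le_coe, NNReal.rpow_two]
  exact (NNReal.sq_sqrt (g x)).le

theorem IsWeight.memLp {w : X → ℝ≥0} (hw : IsWeight w μ) :
    MemLp (fun x => ((w x : ℝ) : ℂ)) 2 μ := by
  refine ⟨(Complex.measurable_ofReal.comp hw.measurable.coe_nnreal_real).aestronglyMeasurable, ?_⟩
  rw [eLpNorm_lt_top_iff_lintegral_rpow_enorm_lt_top two_ne_zero ENNReal.ofNat_ne_top]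
  simpa only [enorm_complex_ofNNReal, ENNReal.toReal_ofNat] using hw.lintegral_sq_lt_top

/-- A weight as an element of `L²`. -/
noncomputable def IsWeight.toLp {w : X → ℝ≥0} (hw : IsWeight w μ) : Lp ℂ 2 μ := hw.memLp.toLp _

theorem IsWeight.coeFn_toLp {w : X → ℝ≥0} (hw : IsWeight w μ) :
    ∀ᵐ x ∂μ, hw.toLp x = ((w x : ℝ) : ℂ) := MemLp.coeFn_toLp _

theorem IsWeight.enorm_coeFn_toLp {w : X → ℝ≥0} (hw : IsWeight w μ) :
    ∀ᵐ x ∂μ, ‖hw.toLp x‖ₑ = w x := by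
  filter_upwards [hw.coeFn_toLp] with x hx
  rw [hx, enorm_complex_ofNNReal]

theorem IsWeight.nonnegAE_toLp {w : X → ℝ≥0} (hw : IsWeight w μ) : NonnegAE hw.toLp := by
  filter_upwards [hw.coeFn_toLp] with x hx
  rw [hx, Complex.norm_real, Real.norm_eq_abs, abs_of_nonneg (w x).coe_nonneg]

/-- The set of all `g` in `L²` with `|g| ≤ w`. -/
def orderInterval (w : X → ℝ≥0) (μ : Measure X) : Set (Lp ℂ 2 μ) :=
  {g | ∀ᵐ x ∂μ, ‖g x‖ₑ ≤ w x}

/-- The operator maps the order interval given by `w` to a totally bounded set. -/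
def IsAMCompact (w : X → ℝ≥0) (T : Op μ) : Prop := TotallyBounded (T '' orderInterval w μ)

theorem isAMCompact_zero (w : X → ℝ≥0) : IsAMCompact w (0 : Op μ) := by
  refine (Set.finite_singleton (0 : Lp ℂ 2 μ)).totallyBounded.subset ?_
  rintro _ ⟨g, -, rfl⟩
  rfl

theorem IsAMCompact.add {w : X → ℝ≥0} {S T : Op μ} (hS : IsAMCompact w S)
    (hT : IsAMCompact w T) : IsAMCompact w (S + T) := by
  have hS' := (TotallyBounded.closure hS).isCompact_of_isClosed isClosed_closure
  have hT' := (TotallyBounded.closure hT).isCompact_of_isClosed isClosed_closure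
  refine (hS'.add hT').totallyBounded.subset ?_
  rintro _ ⟨g, hg, rfl⟩
  exact Set.add_mem_add (subset_closure ⟨g, hg, rfl⟩) (subset_closure ⟨g, hg, rfl⟩)

theorem IsAMCompact.mul_left {w : X → ℝ≥0} {T : Op μ} (hT : IsAMCompact w T) (S : Op μ) :
    IsAMCompact w (S * T) := by
  refine (TotallyBounded.image hT S.uniformContinuous).subset ?_
  rintro _ ⟨g, hg, rfl⟩
  exact ⟨T g, ⟨g, hg, rfl⟩, rfl⟩

/-- The part of `f` on the set where `|f|` exceeds `M w`. -/
noncomputable def tail (w : X → ℝ≥0) (M : ℝ≥0) (f : Lp ℂ 2 μ) : X → ℂ :=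
  {x | M * w x < ‖f x‖₊}.indicator f

theorem measurableSet_tail {w : X → ℝ≥0} (hw : Measurable w) (M : ℝ≥0) (f : Lp ℂ 2 μ) :
    MeasurableSet {x | M * w x < ‖f x‖₊} :=
  measurableSet_lt (hw.const_mul M) (Lp.stronglyMeasurable f).measurable.nnnorm

theorem memLp_tail {w : X → ℝ≥0} (hw : Measurable w) (M : ℝ≥0) (f : Lp ℂ 2 μ) :
    MemLp (tail w M f) 2 μ :=
  (Lp.memLp f).indicator (measurableSet_tail hw M f)

/-- The part of `f` on the set where `|f|` exceeds `M w`, as an element of `L²`. -/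
noncomputable def tailLp {w : X → ℝ≥0} (hw : Measurable w) (M : ℝ≥0) (f : Lp ℂ 2 μ) : Lp ℂ 2 μ :=
  (memLp_tail hw M f).toLp _

theorem coeFn_tailLp {w : X → ℝ≥0} (hw : Measurable w) (M : ℝ≥0) (f : Lp ℂ 2 μ) :
    ∀ᵐ x ∂μ, tailLp hw M f x = tail w M f x := MemLp.coeFn_toLp _

theorem enorm_tail_le (w : X → ℝ≥0) (M : ℝ≥0) (f : Lp ℂ 2 μ) (x : X) :
    ‖tail w M f x‖ₑ ≤ ‖f x‖ₑ := by
  unfold tail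
  by_cases hx : x ∈ {x | M * w x < ‖f x‖₊}
  · rw [Set.indicator_of_mem hx]
  · rw [Set.indicator_of_notMem hx, enorm_zero]; exact zero_le

theorem enorm_sub_tail_le (w : X → ℝ≥0) (M : ℝ≥0) (f : Lp ℂ 2 μ) (x : X) :
    ‖f x - tail w M f x‖ₑ ≤ M * w x := by
  unfold tail
  by_cases hx : x ∈ {x | M * w x < ‖f x‖₊}
  · rw [Set.indicator_of_mem hx, sub_self, enorm_zero]; exact zero_le
  · rw [Set.indicator_of_notMem hx, sub_zero, enorm_eq_nnnorm]
    have : ‖f x‖₊ ≤ M * w x := not_lt.1 hx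
    exact_mod_cast this

theorem enorm_mul_tail_le (w : X → ℝ≥0) (M : ℝ≥0) (f : Lp ℂ 2 μ) (x : X) :
    M * w x * ‖tail w M f x‖ₑ ≤ ‖f x‖ₑ ^ (2 : ℝ) := by
  unfold tail
  by_cases hx : x ∈ {x | M * w x < ‖f x‖₊}
  · rw [Set.indicator_of_mem hx, enorm_eq_nnnorm]
    have : M * w x ≤ ‖f x‖₊ := le_of_lt hx
    norm_cast
    rw [sq]
    gcongr
  · simp [Set.indicator_of_notMem hx]

theorem tendsto_enorm_tailLp {w : X → ℝ≥0} (hw : IsWeight w μ) (f : Lp ℂ 2 μ) :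
    Tendsto (fun K : ℕ => ‖tailLp hw.measurable K f‖ₑ) atTop (𝓝 0) := by
  have h1 : Tendsto (fun K : ℕ => ∫⁻ x, ‖tail w K f x‖ₑ ^ (2 : ℝ) ∂μ) atTop
      (𝓝 (∫⁻ _, 0 ∂μ)) := by
    refine tendsto_lintegral_of_dominated_convergence (fun x => ‖f x‖ₑ ^ (2 : ℝ)) (fun K => ?_)
      (fun K => .of_forall fun x => ?_) ?_ (.of_forall fun x => ?_)
    · exact (((Lp.stronglyMeasurable f).measurable.indicator
        (measurableSet_tail hw.measurable _ f)).enorm).pow_const _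
    · exact ENNReal.rpow_le_rpow (enorm_tail_le _ _ _ _) zero_le_two
    · rw [← enorm_sq_eq_lintegral]
      exact ENNReal.rpow_ne_top_of_nonneg zero_le_two enorm_ne_top
    · refine tendsto_const_nhds.congr' ?_
      obtain ⟨N, hN⟩ := exists_nat_ge (‖f x‖₊ / w x)
      filter_upwards [eventually_ge_atTop N] with K hK
      have h2 : ‖f x‖₊ ≤ K * w x := by
        rw [← div_le_iff₀ (hw.pos x)]
        exact hN.trans (by exact_mod_cast hK)
      have h3 : x ∉ {x | K * w x < ‖f x‖₊} := not_lt.2 h2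
      rw [tail, Set.indicator_of_notMem h3]
      simp
  rw [lintegral_zero] at h1
  have h3 := (ENNReal.continuous_rpow_const (y := 1 / 2)).tendsto (0 : ℝ≥0∞) |>.comp h1
  rw [ENNReal.zero_rpow_of_pos (by norm_num)] at h3
  refine h3.congr fun K => ?_
  have h4 : ∫⁻ x, ‖tail w K f x‖ₑ ^ (2 : ℝ) ∂μ = ‖tailLp hw.measurable K f‖ₑ ^ (2 : ℝ) := by
    rw [enorm_sq_eq_lintegral]
    refine lintegral_congr_ae ?_
    filter_upwards [coeFn_tailLp hw.measurable K f] with x hx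
    rw [hx]
  rw [Function.comp, h4, ← ENNReal.rpow_mul]
  norm_num

/-- The tails of the elements of the unit ball converge weakly to `0`, uniformly. -/
theorem eventually_enorm_inner_tail_le {w : X → ℝ≥0} (hw : IsWeight w μ) (φ : Lp ℂ 2 μ)
    {ε : ℝ≥0} (hε : 0 < ε) :
    ∀ᶠ M : ℝ≥0 in atTop, ∀ f h : Lp ℂ 2 μ, ‖f‖ₑ ≤ 1 → (∀ᵐ x ∂μ, ‖h x‖ₑ ≤ ‖tail w M f x‖ₑ) →
      ‖inner ℂ φ h‖ₑ ≤ ε := by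
  have hε2 : (0 : ℝ≥0∞) < (ε / 2 : ℝ≥0) := by exact_mod_cast half_pos hε
  obtain ⟨K, hK⟩ := ((tendsto_enorm_tailLp hw φ).eventually_lt_const hε2).exists
  filter_upwards [eventually_ge_atTop (K / (ε / 2)), eventually_gt_atTop 0] with M hM hM0 f h hf hh
  set ψ := tailLp hw.measurable K φ
  -- the tail of `φ` is small in norm, and the rest of `φ` is bounded by `K w`, while the product
  -- of `w` and the tail of `f` is at most `|f| ^ 2 / M`
  have h1 : ‖inner ℂ ψ h‖ₑ ≤ (ε / 2 : ℝ≥0) := by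
    have e1 : ‖inner ℂ ψ h‖ₑ ≤ ‖ψ‖ₑ * ‖h‖ₑ := by
      have := norm_inner_le_norm (𝕜 := ℂ) ψ h
      simp only [enorm_eq_nnnorm]
      exact_mod_cast this
    have e2 : ‖h‖ₑ ≤ 1 := (enorm_le_of_ae_enorm_le
      (hh.mono fun x hx => hx.trans (enorm_tail_le _ _ _ _))).trans hf
    exact e1.trans ((mul_le_of_le_one_right' e2).trans hK.le)
  have h2 : ‖inner ℂ (φ - ψ) h‖ₑ ≤ (ε / 2 : ℝ≥0) := by
    refine (enorm_inner_le_lintegral _ _).trans ?_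
    have hKM : K / M ≤ ε / 2 := by
      rw [div_le_iff₀ (half_pos hε)] at hM
      rw [div_le_iff₀ hM0, mul_comm]; exact hM
    calc ∫⁻ x, ‖(φ - ψ) x‖ₑ * ‖h x‖ₑ ∂μ
        ≤ ∫⁻ x, ((ε / 2 : ℝ≥0) : ℝ≥0∞) * ‖f x‖ₑ ^ (2 : ℝ) ∂μ := by
          refine lintegral_mono_ae ?_
          filter_upwards [hh, Lp.coeFn_sub φ ψ, coeFn_tailLp hw.measurable K φ] with x e1 e2 e3
          rw [e2, Pi.sub_apply, e3]
          have e4 : (K : ℝ≥0∞) = ((K / M : ℝ≥0) : ℝ≥0∞) * M := by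
            rw [← ENNReal.coe_mul, div_mul_cancel₀ _ hM0.ne']
            simp
          calc ‖φ x - tail w K φ x‖ₑ * ‖h x‖ₑ
              ≤ ((K : ℝ≥0) * w x) * ‖tail w M f x‖ₑ :=
                mul_le_mul' (enorm_sub_tail_le _ _ _ _) e1
            _ = ((K / M : ℝ≥0) : ℝ≥0∞) * (M * w x * ‖tail w M f x‖ₑ) := by
                rw [ENNReal.coe_natCast, e4]; ring
            _ ≤ _ := mul_le_mul' (by exact_mod_cast hKM) (enorm_mul_tail_le _ _ _ _)
      _ = (ε / 2 : ℝ≥0) * ‖f‖ₑ ^ (2 : ℝ) := by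
          rw [lintegral_const_mul'' _ ((aemeasurable_enorm f).pow_const _), enorm_sq_eq_lintegral]
      _ ≤ (ε / 2 : ℝ≥0) := mul_le_of_le_one_right' (by
          simpa using ENNReal.rpow_le_rpow hf zero_le_two)
  have h3 : inner ℂ φ h = inner ℂ ψ h + inner ℂ (φ - ψ) h := by
    rw [← inner_add_left, add_sub_cancel]
  rw [h3]
  calc _ ≤ _ := enorm_add_le _ _
    _ ≤ ((ε / 2 : ℝ≥0) : ℝ≥0∞) + (ε / 2 : ℝ≥0) := add_le_add h1 h2
    _ = ε := by rw [← ENNReal.coe_add, add_halves]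

/-- The measure of non-compactness controls the operator on tails: on them the operator is
weakly small, so that the finitely many centres of a covering of the image of the unit ball
do not help. -/
theorem eventually_enorm_apply_tail_le {w : X → ℝ≥0} (hw : IsWeight w μ) {A : Op μ} {a : ℝ≥0}
    (hA : hausdorffMeas A < a) :
    ∀ᶠ M : ℝ≥0 in atTop, ∀ f h : Lp ℂ 2 μ, ‖f‖ₑ ≤ 1 → (∀ᵐ x ∂μ, ‖h x‖ₑ ≤ ‖tail w M f x‖ₑ) →
      ‖A h‖ₑ ≤ a := by
  obtain ⟨δ, hδ, C, hC, hAC⟩ := exists_finite_of_hausdorffMeas_lt hA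
  have hδa : δ < a := by exact_mod_cast hδ
  have hε : 0 < (a ^ 2 - δ ^ 2) / 2 :=
    half_pos (tsub_pos_of_lt (pow_lt_pow_left₀ hδa zero_le two_ne_zero))
  have hev := (Filter.eventually_all_finite hC).2 fun m _ =>
    eventually_enorm_inner_tail_le hw (ContinuousLinearMap.adjoint A m) hε
  filter_upwards [hev] with M hM f h hf hh
  have hh1 : ‖h‖ₑ ≤ 1 := (enorm_le_of_ae_enorm_le
      (hh.mono fun x hx => hx.trans (enorm_tail_le _ _ _ _))).trans hf
  have hh2 : ‖h‖ ≤ 1 := by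
    rw [enorm_eq_nnnorm] at hh1; exact_mod_cast hh1
  obtain ⟨m, hm, hAm⟩ := hAC h hh2
  have h1 := hM m hm f h hf hh
  rw [ContinuousLinearMap.adjoint_inner_left] at h1
  have h2 : ‖inner ℂ m (A h)‖ ≤ ((a : ℝ) ^ 2 - δ ^ 2) / 2 := by
    rw [enorm_eq_nnnorm] at h1
    have h3 : ‖inner ℂ m (A h)‖ ≤ (((a ^ 2 - δ ^ 2) / 2 : ℝ≥0) : ℝ) := by exact_mod_cast h1
    rwa [NNReal.coe_div, NNReal.coe_sub (by gcongr)] at h3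
  have h4 := norm_sub_sq (𝕜 := ℂ) (A h) m
  have h5 : RCLike.re (inner ℂ (A h) m) ≤ ‖inner ℂ m (A h)‖ := by
    rw [norm_inner_symm]; exact RCLike.re_le_norm _
  have h6 : ‖A h‖ ^ 2 ≤ (a : ℝ) ^ 2 := by
    have : ‖A h - m‖ ^ 2 ≤ (δ : ℝ) ^ 2 := by gcongr
    nlinarith [sq_nonneg ‖m‖]
  have h7 : ‖A h‖ ≤ a := (pow_le_pow_iff_left₀ (norm_nonneg _) a.coe_nonneg two_ne_zero).1 h6
  rw [enorm_eq_nnnorm]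
  exact_mod_cast h7

/-- For an operator `T` that is compact on order intervals, only the tails of the elements of the
unit ball contribute to the measure of non-compactness, and there `T` is dominated. -/
theorem Dominated.hausdorffMeas_le {α : ℝ} (h0 : 0 ≤ α) (h1 : α ≤ 1) {w : X → ℝ≥0}
    (hw : IsWeight w μ) {T A B : Op μ} (h : Dominated α T A B) (hT : IsAMCompact w T) :
    hausdorffMeas T ≤ hausdorffMeas A ^ α * hausdorffMeas B ^ (1 - α) := by
  have h1' := sub_nonneg.2 h1
  have key : ∀ a b : ℝ≥0, hausdorffMeas A < a → hausdorffMeas B < b →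
      hausdorffMeas T ≤ (a : ℝ≥0∞) ^ α * (b : ℝ≥0∞) ^ (1 - α) := by
    intro a b ha hb
    obtain ⟨M, hMA, hMB, hM0⟩ := ((eventually_enorm_apply_tail_le hw ha).and
      ((eventually_enorm_apply_tail_le hw hb).and (eventually_gt_atTop 0))).exists
    rw [← ENNReal.coe_rpow_of_nonneg _ h0, ← ENNReal.coe_rpow_of_nonneg _ h1', ← ENNReal.coe_mul]
    refine hausdorffMeas_le_of_totallyBounded
      (TotallyBounded.image hT (uniformContinuous_const_smul (M : ℂ))) fun f hf => ?_
    have hf' : ‖f‖ₑ ≤ 1 := by rw [enorm_eq_nnnorm]; exact_mod_cast hf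
    have hM : ((M : ℝ) : ℂ) ≠ 0 := by exact_mod_cast hM0.ne'
    set t := tailLp hw.measurable M f
    refine ⟨T (f - t), ⟨T (((M : ℝ) : ℂ)⁻¹ • (f - t)), ⟨_, ?_, rfl⟩, ?_⟩, ?_⟩
    · filter_upwards [Lp.coeFn_smul ((M : ℝ) : ℂ)⁻¹ (f - t), Lp.coeFn_sub f t,
        coeFn_tailLp hw.measurable M f] with x e1 e2 e3
      rw [e1, Pi.smul_apply, e2, Pi.sub_apply, e3, enorm_smul, enorm_inv hM,
        enorm_complex_ofNNReal]
      refine (mul_le_mul_right (enorm_sub_tail_le _ _ _ _) _).trans_eq ?_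
      rw [← mul_assoc, ENNReal.inv_mul_cancel (by exact_mod_cast hM0.ne') ENNReal.coe_ne_top,
        one_mul]
    · change ((M : ℝ) : ℂ) • T (((M : ℝ) : ℂ)⁻¹ • (f - t)) = _
      rw [map_smul, smul_inv_smul₀ hM]
    · have e1 : T f - T (f - t) = T t := by rw [map_sub, sub_sub_cancel]
      have e2 : ∀ᵐ x ∂μ, ‖absLp t x‖ₑ ≤ ‖tail w M f x‖ₑ := by
        filter_upwards [enorm_coeFn_absLp t, coeFn_tailLp hw.measurable M f] with x e2 e3
        rw [e2, e3]
      have e3 : ‖T t‖ₑ ≤ (a : ℝ≥0∞) ^ α * (b : ℝ≥0∞) ^ (1 - α) :=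
        (enorm_le_rpow_mul_rpow h0 h1 (h.enorm_apply_le h0 h1 t)).trans (mul_le_mul'
          (ENNReal.rpow_le_rpow (hMA f _ hf' e2) h0) (ENNReal.rpow_le_rpow (hMB f _ hf' e2) h1'))
      rw [← ENNReal.coe_rpow_of_nonneg _ h0, ← ENNReal.coe_rpow_of_nonneg _ h1',
        ← ENNReal.coe_mul, enorm_eq_nnnorm, ENNReal.coe_le_coe] at e3
      rw [e1]
      exact_mod_cast e3
  -- let `a` and `b` decrease to the measures of non-compactness of `A` and `B`
  obtain ⟨a, ha⟩ := WithTop.ne_top_iff_exists.1 (hausdorffMeas_ne_top A)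
  obtain ⟨b, hb⟩ := WithTop.ne_top_iff_exists.1 (hausdorffMeas_ne_top B)
  have hlim : ∀ c : ℝ≥0, Tendsto (fun ε : ℝ≥0 => ((c + ε : ℝ≥0) : ℝ≥0∞)) (𝓝[>] 0) (𝓝 c) := by
    intro c
    have : Continuous fun ε : ℝ≥0 => ((c + ε : ℝ≥0) : ℝ≥0∞) := by fun_prop
    simpa using (this.tendsto 0).mono_left nhdsWithin_le_nhds
  rw [← ha, ← hb]
  refine ge_of_tendsto (ENNReal.Tendsto.mul
    ((ENNReal.continuous_rpow_const.tendsto _).comp (hlim a))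
    (.inr (ENNReal.rpow_ne_top_of_nonneg h1' ENNReal.coe_ne_top))
    ((ENNReal.continuous_rpow_const.tendsto _).comp (hlim b))
    (.inr (ENNReal.rpow_ne_top_of_nonneg h0 ENNReal.coe_ne_top))) ?_
  filter_upwards [self_mem_nhdsWithin] with ε hε
  have hε' : 0 < ε := hε
  refine key _ _ ?_ ?_
  · rw [← ha]; exact ENNReal.coe_lt_coe.2 (lt_add_of_pos_right a hε')
  · rw [← hb]; exact ENNReal.coe_lt_coe.2 (lt_add_of_pos_right b hε')

theorem isAMCompact_pow {w : X → ℝ≥0} {T : Op μ} (hT : IsAMCompact w T) {k : ℕ} (hk : k ≠ 0) :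
    IsAMCompact w (T ^ k) := by
  obtain ⟨j, rfl⟩ := Nat.exists_eq_succ_of_ne_zero hk
  rw [Nat.succ_eq_add_one, pow_succ]
  exact hT.mul_left _

theorem Dominated.essRadius_le {α : ℝ} (h0 : 0 ≤ α) (h1 : α ≤ 1) {w : X → ℝ≥0}
    (hw : IsWeight w μ) {T A B : Op μ} (h : Dominated α T A B) (hT : IsAMCompact w T) :
    essRadius T ≤ essRadius A ^ α * essRadius B ^ (1 - α) := by
  have hA := tendsto_hausdorffMeas_pow_essRadius A
  have hB := tendsto_hausdorffMeas_pow_essRadius B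
  have h1' := sub_nonneg.2 h1
  have hAf : essRadius A ^ α ≠ ∞ := ENNReal.rpow_ne_top_of_nonneg h0
    ((essRadius_le_enorm A).trans_lt enorm_lt_top).ne
  have hBf : essRadius B ^ (1 - α) ≠ ∞ := ENNReal.rpow_ne_top_of_nonneg h1'
    ((essRadius_le_enorm B).trans_lt enorm_lt_top).ne
  refine le_of_tendsto_of_tendsto (tendsto_hausdorffMeas_pow_essRadius T)
    (ENNReal.Tendsto.mul ((ENNReal.continuous_rpow_const.tendsto _).comp hA) (.inr hBf)
      ((ENNReal.continuous_rpow_const.tendsto _).comp hB) (.inr hAf))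
    ((eventually_ne_atTop 0).mono fun k hk0 => ?_)
  have hk : (0 : ℝ) ≤ 1 / k := by positivity
  refine (ENNReal.rpow_le_rpow ((h.pow k).hausdorffMeas_le h0 h1 hw
    (isAMCompact_pow hT hk0)) hk).trans_eq ?_
  simp only [Function.comp]
  rw [ENNReal.mul_rpow_of_nonneg _ _ hk, ennreal_rpow_comm,
    ennreal_rpow_comm (hausdorffMeas (B ^ k))]

/-! ### Operators with nonnegative kernels -/

theorem HasKernel.aemeasurable {A : Op μ} {a : X → X → ℝ≥0}
    (hA : HasKernel A fun x y => ((a x y : ℝ) : ℂ)) :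
    AEMeasurable (fun p : X × X => a p.1 p.2) (μ.prod μ) := by
  simpa using hA.aestronglyMeasurable.norm.aemeasurable.real_toNNReal

theorem aestronglyMeasurable_kernel {a : X × X → ℝ≥0} (ha : AEMeasurable a (μ.prod μ)) :
    AEStronglyMeasurable (fun p => ((a p : ℝ) : ℂ)) (μ.prod μ) :=
  (Complex.measurable_ofReal.comp_aemeasurable ha.coe_nnreal_real).aestronglyMeasurable

theorem ae_aemeasurable_section [SFinite μ] {a : X → X → ℝ≥0}
    (ha : AEMeasurable (fun p : X × X => a p.1 p.2) (μ.prod μ)) :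
    ∀ᵐ x ∂μ, AEMeasurable (fun y => a x y) μ := by
  filter_upwards [ha.aestronglyMeasurable.prodMk_left] with x hx using hx.aemeasurable

theorem HasKernel.sub {A B : Op μ} {k l : X → X → ℂ} (hA : HasKernel A k) (hB : HasKernel B l) :
    HasKernel (A - B) (fun x y => k x y - l x y) where
  aestronglyMeasurable := hA.aestronglyMeasurable.sub hB.aestronglyMeasurable
  integrable f := by
    filter_upwards [hA.integrable f, hB.integrable f] with x h1 h2
    simp only [sub_mul]
    exact h1.sub h2
  apply_eq f := by
    filter_upwards [hA.integrable f, hB.integrable f, hA.apply_eq f, hB.apply_eq f,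
      Lp.coeFn_sub (A f) (B f)] with x h1 h2 h3 h4 h5
    simp only [sub_mul]
    rw [_root_.sub_apply, h5, Pi.sub_apply, h3, h4, integral_sub h1 h2]

theorem enorm_kernel_mul (a : ℝ≥0) (z : ℂ) : ‖((a : ℝ) : ℂ) * z‖ₑ = a * ‖z‖ₑ := by
  rw [enorm_mul, enorm_complex_ofNNReal]

theorem HasKernel.enorm_apply_le {A : Op μ} {a : X → X → ℝ≥0}
    (hA : HasKernel A fun x y => ((a x y : ℝ) : ℂ)) (f : Lp ℂ 2 μ) :
    ∀ᵐ x ∂μ, ‖A f x‖ₑ ≤ ∫⁻ y, a x y * ‖f y‖ₑ ∂μ := by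
  filter_upwards [hA.apply_eq f] with x hx
  rw [hx]
  exact (enorm_integral_le_lintegral_enorm _).trans_eq
    (lintegral_congr fun y => enorm_kernel_mul _ _)

theorem HasKernel.apply_eq_ofReal {A : Op μ} {a : X → X → ℝ≥0}
    (hA : HasKernel A fun x y => ((a x y : ℝ) : ℂ)) {f : Lp ℂ 2 μ} (hf : NonnegAE f) :
    ∀ᵐ x ∂μ, A f x = ((∫ y, (a x y : ℝ) * ‖f y‖ ∂μ : ℝ) : ℂ) := by
  filter_upwards [hA.apply_eq f] with x hx
  rw [hx, ← integral_complex_ofReal]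
  refine integral_congr_ae ?_
  filter_upwards [hf] with y hy
  rw [Complex.ofReal_mul, ← hy]

theorem HasKernel.nonnegAE_apply {A : Op μ} {a : X → X → ℝ≥0}
    (hA : HasKernel A fun x y => ((a x y : ℝ) : ℂ)) {f : Lp ℂ 2 μ} (hf : NonnegAE f) :
    NonnegAE (A f) := by
  filter_upwards [hA.apply_eq_ofReal hf] with x hx
  have : 0 ≤ ∫ y, (a x y : ℝ) * ‖f y‖ ∂μ := integral_nonneg fun y => by positivity
  rw [hx, Complex.norm_real, Real.norm_eq_abs, abs_of_nonneg this]

theorem HasKernel.enorm_apply_eq {A : Op μ} {a : X → X → ℝ≥0}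
    (hA : HasKernel A fun x y => ((a x y : ℝ) : ℂ)) {f : Lp ℂ 2 μ} (hf : NonnegAE f) :
    ∀ᵐ x ∂μ, ‖A f x‖ₑ = ∫⁻ y, a x y * ‖f y‖ₑ ∂μ := by
  filter_upwards [hA.apply_eq_ofReal hf, hA.integrable f] with x hx hi
  have h1 : 0 ≤ ∫ y, (a x y : ℝ) * ‖f y‖ ∂μ := integral_nonneg fun y => by positivity
  have hi' : Integrable (fun y => (a x y : ℝ) * ‖f y‖) μ := by
    refine hi.norm.congr (.of_forall fun y => ?_)
    simp
  rw [hx, ← ofReal_norm, Complex.norm_real, Real.norm_eq_abs, abs_of_nonneg h1,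
    ofReal_integral_eq_lintegral_ofReal hi' (.of_forall fun y => by positivity)]
  refine lintegral_congr fun y => ?_
  rw [ENNReal.ofReal_mul (a x y).coe_nonneg, ofReal_norm, ENNReal.ofReal_coe_nnreal]

/-- Hölder's inequality with respect to the second variable of the kernels. -/
theorem dominated_of_hasKernel [SFinite μ] {α : ℝ} (h0 : 0 ≤ α) (h1 : α ≤ 1) {T A B : Op μ}
    {a b : X → X → ℝ≥0} (hA : HasKernel A fun x y => ((a x y : ℝ) : ℂ))
    (hB : HasKernel B fun x y => ((b x y : ℝ) : ℂ))
    (hT : HasKernel T fun x y => (((a x y) ^ α * (b x y) ^ (1 - α) : ℝ≥0) : ℂ)) :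
    Dominated α T A B where
  nonneg_left f hf := hA.nonnegAE_apply hf
  nonneg_right f hf := hB.nonnegAE_apply hf
  enorm_le f g h hf hg hh := by
    have h1' := sub_nonneg.2 h1
    filter_upwards [HasKernel.enorm_apply_le (a := fun x y => (a x y) ^ α * (b x y) ^ (1 - α)) hT h,
      hA.enorm_apply_eq hf, hB.enorm_apply_eq hg, ae_aemeasurable_section hA.aemeasurable,
      ae_aemeasurable_section hB.aemeasurable] with x e1 e2 e3 e4 e5
    rw [e2, e3]
    refine e1.trans (le_trans (lintegral_mono_ae ?_) (ENNReal.lintegral_mul_norm_pow_le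
      (e4.coe_nnreal_ennreal.mul (aemeasurable_enorm f))
      (e5.coe_nnreal_ennreal.mul (aemeasurable_enorm g)) h0 h1' (add_sub_cancel _ _)))
    filter_upwards [hh] with y hy
    simp only [Pi.mul_apply]
    rw [ENNReal.mul_rpow_of_nonneg _ _ h0, ENNReal.mul_rpow_of_nonneg _ _ h1', ENNReal.coe_mul,
      ENNReal.coe_rpow_of_nonneg _ h0, ENNReal.coe_rpow_of_nonneg _ h1', mul_mul_mul_comm]
    gcongr

/-- A measurable nonnegative kernel below the kernel of a bounded operator is itself the kernel
of a bounded operator. -/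
theorem exists_hasKernel_of_le [SigmaFinite μ] {A : Op μ} {a s : X → X → ℝ≥0}
    (hA : HasKernel A fun x y => ((a x y : ℝ) : ℂ))
    (hs : AEMeasurable (fun p : X × X => s p.1 p.2) (μ.prod μ)) (hle : ∀ x y, s x y ≤ a x y) :
    ∃ T : Op μ, HasKernel T fun x y => ((s x y : ℝ) : ℂ) := by
  have hm := aestronglyMeasurable_kernel hs
  have key : ∀ f : Lp ℂ 2 μ, ∀ᵐ x ∂μ, Integrable (fun y => ((s x y : ℝ) : ℂ) * f y) μ ∧
      ‖∫ y, ((s x y : ℝ) : ℂ) * f y ∂μ‖ₑ ≤ ‖A (absLp f) x‖ₑ := by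
    intro f
    filter_upwards [hA.integrable f, hA.enorm_apply_eq (nonnegAE_absLp f), hm.prodMk_left]
      with x h1 h2 h3
    refine ⟨h1.mono (h3.mul (Lp.aestronglyMeasurable f)) (.of_forall fun y => ?_), ?_⟩
    · simp only [norm_mul, Complex.norm_real, NNReal.norm_eq]
      gcongr
      exact hle x y
    · rw [h2]
      refine (enorm_integral_le_lintegral_enorm _).trans (lintegral_mono_ae ?_)
      filter_upwards [enorm_coeFn_absLp f] with y hy
      rw [enorm_kernel_mul, hy]
      gcongr
      exact hle x y
  have hLp : ∀ f : Lp ℂ 2 μ, MemLp (fun x => ∫ y, ((s x y : ℝ) : ℂ) * f y ∂μ) 2 μ := fun f =>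
    ⟨(hm.mul (Lp.aestronglyMeasurable f).comp_snd).integral_prod_right',
      (eLpNorm_mono_enorm_ae ((key f).mono fun x hx => hx.2)).trans_lt
        (Lp.memLp (A (absLp f))).2⟩
  let L : Lp ℂ 2 μ →ₗ[ℂ] Lp ℂ 2 μ :=
    { toFun := fun f => (hLp f).toLp _
      map_add' := by
        intro f g
        rw [← MemLp.toLp_add]
        refine (MemLp.toLp_eq_toLp_iff _ _).2 ?_
        filter_upwards [key f, key g] with x hf hg
        rw [Pi.add_apply, ← integral_add hf.1 hg.1]
        refine integral_congr_ae ?_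
        filter_upwards [Lp.coeFn_add f g] with y hy
        rw [hy, Pi.add_apply, mul_add]
      map_smul' := by
        intro c f
        rw [RingHom.id_apply, ← MemLp.toLp_const_smul]
        refine (MemLp.toLp_eq_toLp_iff _ _).2 (.of_forall fun x => ?_)
        simp only [Pi.smul_apply, smul_eq_mul]
        rw [← integral_const_mul]
        refine integral_congr_ae ?_
        filter_upwards [Lp.coeFn_smul c f] with y hy
        rw [hy, Pi.smul_apply, smul_eq_mul]
        ring }
  have hL : ∀ f, ‖L f‖ₑ ≤ ‖A‖ₑ * ‖f‖ₑ := fun f => by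
    rw [← enorm_absLp f]
    refine le_trans (enorm_le_of_ae_enorm_le ?_) (A.le_opENorm (absLp f))
    filter_upwards [key f, MemLp.coeFn_toLp (hLp f)] with x hx hx'
    exact (congrArg enorm hx').le.trans hx.2
  refine ⟨L.mkContinuous ‖A‖ fun f => ?_, hm, fun f => (key f).mono fun x hx => hx.1,
    fun f => MemLp.coeFn_toLp (hLp f)⟩
  have := hL f
  simp only [enorm_eq_nnnorm] at this
  exact_mod_cast this

theorem sum_enorm_sq_le_iff {ι E F : Type*} [Fintype ι] [SeminormedAddCommGroup E]
    [SeminormedAddCommGroup F] {f : ι → E} {g : F} :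
    ∑ i, ‖f i‖ₑ ^ (2 : ℝ) ≤ ‖g‖ₑ ^ (2 : ℝ) ↔ ∑ i, ‖f i‖ ^ 2 ≤ ‖g‖ ^ 2 := by
  have h : ∑ i, ‖f i‖ₑ ^ (2 : ℝ) ≤ ‖g‖ₑ ^ (2 : ℝ) ↔ ∑ i, ‖f i‖₊ ^ 2 ≤ ‖g‖₊ ^ 2 := by
    simp only [enorm_eq_nnnorm, ENNReal.rpow_two]
    norm_cast
  rw [h, ← NNReal.coe_le_coe]
  push_cast
  rfl

/-- An operator whose kernel is bounded by a multiple of `w ⊗ w` is of Hilbert–Schmidt type: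
Bessel's inequality for the sections of the kernel bounds the sum of `‖S (v i)‖ ^ 2`. -/
theorem isCompactOperator_of_kernel_le [SigmaFinite μ] {w : X → ℝ≥0} (hw : IsWeight w μ)
    {S : Op μ} {s : X → X → ℝ≥0} (hS : HasKernel S fun x y => ((s x y : ℝ) : ℂ)) (c : ℝ≥0)
    (hs : ∀ x y, s x y ≤ c * w x * w y) : IsCompactOperator S := by
  set W := hw.toLp
  set G : Lp ℂ 2 μ := ((c * ‖W‖₊ : ℝ≥0) : ℂ) • W
  refine isCompactOperator_of_sum_sq_le S (‖G‖ ^ 2) fun n v hv => ?_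
  have hpt : ∀ᵐ x ∂μ, ∑ i, ‖S (v i) x‖ₑ ^ (2 : ℝ) ≤ ‖G x‖ₑ ^ (2 : ℝ) := by
    filter_upwards [ae_all_iff.2 fun i => hS.apply_eq (v i), ae_aemeasurable_section hS.aemeasurable,
      Lp.coeFn_smul ((c * ‖W‖₊ : ℝ≥0) : ℂ) W, hw.coeFn_toLp] with x e1 e2 e3 e4
    have hmem : MemLp (fun y => ((s x y : ℝ) : ℂ)) 2 μ := by
      refine (hw.memLp.const_mul ((c * w x : ℝ≥0) : ℂ)).mono
        (Complex.measurable_ofReal.comp_aemeasurable e2.coe_nnreal_real).aestronglyMeasurable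
        (.of_forall fun y => ?_)
      rw [norm_mul, Complex.norm_real, Complex.norm_real, Complex.norm_real, NNReal.norm_eq,
        NNReal.norm_eq, NNReal.norm_eq]
      exact_mod_cast hs x y
    have hin : ∀ i, ‖S (v i) x‖ = ‖inner ℂ (v i) (hmem.toLp _)‖ := by
      intro i
      rw [norm_inner_symm, L2.inner_def, e1 i]
      congr 1
      refine integral_congr_ae ?_
      filter_upwards [hmem.coeFn_toLp] with y hy
      rw [hy]
      simp [mul_comm]
    have hnorm : ‖hmem.toLp _‖ ≤ ‖G x‖ := by
      have h1 : ‖hmem.toLp _‖ ≤ (c * w x : ℝ≥0) * ‖W‖ := by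
        refine Lp.norm_le_mul_norm_of_ae_le_mul ?_
        filter_upwards [hmem.coeFn_toLp, hw.coeFn_toLp] with y h1 h2
        rw [h1, h2, Complex.norm_real, Complex.norm_real, NNReal.norm_eq, NNReal.norm_eq]
        exact_mod_cast hs x y
      refine h1.trans_eq ?_
      rw [e3, Pi.smul_apply, e4, norm_smul, Complex.norm_real, Complex.norm_real, NNReal.norm_eq,
        NNReal.norm_eq]
      push_cast
      ring
    have hB : ∑ i, ‖S (v i) x‖ ^ 2 ≤ ‖G x‖ ^ 2 := by
      calc ∑ i, ‖S (v i) x‖ ^ 2 = ∑ i, ‖inner ℂ (v i) (hmem.toLp _)‖ ^ 2 :=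
            Finset.sum_congr rfl fun i _ => by rw [hin]
        _ ≤ ‖hmem.toLp _‖ ^ 2 := hv.sum_inner_products_le _
        _ ≤ _ := by gcongr
    exact sum_enorm_sq_le_iff.2 hB
  have hsum : ∑ i, ‖S (v i)‖ₑ ^ (2 : ℝ) ≤ ‖G‖ₑ ^ (2 : ℝ) := by
    simp only [enorm_sq_eq_lintegral]
    rw [← lintegral_finsetSum' _ fun i _ => (aemeasurable_enorm _).pow_const _]
    exact lintegral_mono_ae hpt
  exact sum_enorm_sq_le_iff.1 hsum

theorem HasKernel.enorm_apply_le_of_mem_orderInterval {w : X → ℝ≥0} (hw : IsWeight w μ)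
    {A : Op μ} {a : X → X → ℝ≥0} (hA : HasKernel A fun x y => ((a x y : ℝ) : ℂ))
    {g : Lp ℂ 2 μ} (hg : g ∈ orderInterval w μ) : ‖A g‖ₑ ≤ ‖A hw.toLp‖ₑ := by
  refine enorm_le_of_ae_enorm_le ?_
  filter_upwards [hA.enorm_apply_le g, hA.enorm_apply_eq hw.nonnegAE_toLp] with x h1 h2
  rw [h2]
  refine h1.trans (lintegral_mono_ae ?_)
  filter_upwards [hg, hw.enorm_coeFn_toLp] with y h3 h4
  rw [h4]
  gcongr

/-- A positive kernel operator is compact on order intervals: it is approximated, on the order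
interval, by the operators with the truncated kernels `min t (n w ⊗ w)`. -/
theorem HasKernel.isAMCompact [SigmaFinite μ] {w : X → ℝ≥0} (hw : IsWeight w μ) {T : Op μ}
    {t : X → X → ℝ≥0} (hT : HasKernel T fun x y => ((t x y : ℝ) : ℂ)) : IsAMCompact w T := by
  have hwm : Measurable fun p : X × X => w p.1 * w p.2 :=
    (hw.measurable.comp measurable_fst).mul (hw.measurable.comp measurable_snd)
  have hex : ∀ n : ℕ, ∃ U : Op μ,
      HasKernel U fun x y => ((t x y - n * (w x * w y) : ℝ≥0) : ℂ) := fun n =>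
    exists_hasKernel_of_le hT (hT.aemeasurable.sub (hwm.const_mul (n : ℝ≥0)).aemeasurable)
      fun x y => tsub_le_self
  choose U hU using hex
  have hcomp : ∀ n, IsCompactOperator (T - U n) := by
    intro n
    have h1 := hT.sub (hU n)
    have h2 : (fun x y => ((t x y : ℝ) : ℂ) - ((t x y - n * (w x * w y) : ℝ≥0) : ℂ)) =
        fun x y => ((min (t x y) (n * (w x * w y)) : ℝ≥0) : ℂ) := by
      funext x y
      rw [← tsub_tsub_eq_min, ← Complex.ofReal_sub, NNReal.coe_sub tsub_le_self]
    rw [h2] at h1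
    refine isCompactOperator_of_kernel_le hw (s := fun x y => min (t x y) (n * (w x * w y))) h1 n
      fun x y => ?_
    rw [mul_assoc]
    exact min_le_right _ _
  have hlim : Tendsto (fun n => ‖U n hw.toLp‖ₑ ^ (2 : ℝ)) atTop (𝓝 0) := by
    have h1 : Tendsto (fun n => ∫⁻ x, ‖U n hw.toLp x‖ₑ ^ (2 : ℝ) ∂μ) atTop (𝓝 (∫⁻ _, 0 ∂μ)) := by
      refine tendsto_lintegral_of_dominated_convergence' (fun x => ‖T hw.toLp x‖ₑ ^ (2 : ℝ))
        (fun n => (aemeasurable_enorm _).pow_const _) (fun n => ?_) ?_ ?_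
      · filter_upwards [(hU n).enorm_apply_eq hw.nonnegAE_toLp,
          hT.enorm_apply_eq hw.nonnegAE_toLp] with x e1 e2
        rw [e1, e2]
        refine ENNReal.rpow_le_rpow (lintegral_mono fun y => ?_) zero_le_two
        gcongr
        exact tsub_le_self
      · rw [← enorm_sq_eq_lintegral]
        exact ENNReal.rpow_ne_top_of_nonneg zero_le_two enorm_ne_top
      · filter_upwards [ae_all_iff.2 fun n => (hU n).enorm_apply_eq hw.nonnegAE_toLp,
          hT.enorm_apply_eq hw.nonnegAE_toLp, ae_aemeasurable_section hT.aemeasurable,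
          ae_lt_top' ((aemeasurable_enorm (T hw.toLp)).pow_const (2 : ℝ)) (by
            rw [← enorm_sq_eq_lintegral]
            exact ENNReal.rpow_ne_top_of_nonneg zero_le_two enorm_ne_top)] with x e1 e2 e3 e4
        have h2 : Tendsto (fun n : ℕ => ∫⁻ y,
            ((t x y - n * (w x * w y) : ℝ≥0) : ℝ≥0∞) * ‖hw.toLp y‖ₑ ∂μ) atTop
            (𝓝 (∫⁻ _, 0 ∂μ)) := by
          refine tendsto_lintegral_of_dominated_convergence'
            (fun y => (t x y : ℝ≥0∞) * ‖hw.toLp y‖ₑ) (fun n => ?_)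
            (fun n => .of_forall fun y => ?_) ?_ (.of_forall fun y => ?_)
          · exact (e3.sub ((hw.measurable.const_mul _).const_mul _).aemeasurable
              ).coe_nnreal_ennreal.mul (aemeasurable_enorm _)
          · dsimp only
            gcongr
            exact tsub_le_self
          · rw [← e2]; exact enorm_ne_top
          · refine tendsto_const_nhds.congr' ?_
            have hp : 0 < w x * w y := mul_pos (hw.pos x) (hw.pos y)
            obtain ⟨N, hN⟩ := exists_nat_ge (t x y / (w x * w y))
            filter_upwards [eventually_ge_atTop N] with n hn
            have h3 : t x y ≤ n * (w x * w y) := by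
              rw [← div_le_iff₀ hp]
              exact hN.trans (by exact_mod_cast hn)
            rw [tsub_eq_zero_of_le h3]
            simp
        rw [lintegral_zero] at h2
        have h4 := ((ENNReal.continuous_rpow_const (y := 2)).tendsto (0 : ℝ≥0∞)).comp h2
        rw [ENNReal.zero_rpow_of_pos two_pos] at h4
        refine h4.congr fun n => ?_
        rw [Function.comp, e1 n]
    simpa only [lintegral_zero, ← enorm_sq_eq_lintegral] using h1
  refine Metric.totallyBounded_iff.2 fun ε hε => ?_
  have hε' : (0 : ℝ≥0∞) < ENNReal.ofReal (ε / 2) ^ (2 : ℝ) :=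
    ENNReal.rpow_pos (by simpa using hε) ENNReal.ofReal_ne_top
  obtain ⟨n, hn⟩ := (hlim.eventually_lt_const hε').exists
  rw [ENNReal.rpow_lt_rpow_iff two_pos] at hn
  have hbd : Bornology.IsBounded (orderInterval w μ) := by
    refine (Metric.isBounded_closedBall (x := (0 : Lp ℂ 2 μ)) (r := ‖hw.toLp‖)).subset ?_
    intro g hg
    have h1 : ‖g‖ₑ ≤ ‖hw.toLp‖ₑ := by
      refine enorm_le_of_ae_enorm_le ?_
      filter_upwards [hg, hw.enorm_coeFn_toLp] with y h3 h4
      rwa [h4]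
    rw [mem_closedBall_zero_iff]
    simp only [enorm_eq_nnnorm] at h1
    exact_mod_cast h1
  have htb : TotallyBounded ((T - U n) '' orderInterval w μ) :=
    (IsCompactOperator.isCompact_closure_image_of_bounded
      (f := ((T - U n : Op μ) : Lp ℂ 2 μ →ₗ[ℂ] Lp ℂ 2 μ)) (hcomp n) hbd).totallyBounded.subset
      subset_closure
  obtain ⟨F, hF, hcov⟩ := Metric.totallyBounded_iff.1 htb (ε / 2) (half_pos hε)
  refine ⟨F, hF, ?_⟩
  rintro _ ⟨g, hg, rfl⟩
  obtain ⟨y, hy, hgy⟩ := Set.mem_iUnion₂.1 (hcov ⟨g, hg, rfl⟩)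
  refine Set.mem_iUnion₂.2 ⟨y, hy, ?_⟩
  have h1 : ‖U n g‖ < ε / 2 := by
    have := (HasKernel.enorm_apply_le_of_mem_orderInterval
      (a := fun x y => t x y - n * (w x * w y)) hw (hU n) hg).trans_lt hn
    rw [← ofReal_norm] at this
    exact (ENNReal.ofReal_lt_ofReal_iff (half_pos hε)).1 this
  have h2 : ‖(T - U n) g - y‖ < ε / 2 := by
    rw [← dist_eq_norm]; exact hgy
  rw [Metric.mem_ball, dist_eq_norm]
  have h3 : T g - y = ((T - U n) g - y) + U n g := by
    rw [_root_.sub_apply]; abel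
  rw [h3]
  exact (norm_add_le _ _).trans_lt (by linarith)

/-! ### Transposed kernels and iterated symmetrizations -/

theorem HasKernel.integrable_prod [SigmaFinite μ] {A : Op μ} {a : X → X → ℝ≥0}
    (hA : HasKernel A fun x y => ((a x y : ℝ) : ℂ)) (f g : Lp ℂ 2 μ) :
    Integrable (fun p : X × X => ((a p.1 p.2 : ℝ) : ℂ) * g p.2 * f p.1) (μ.prod μ) := by
  have hm : AEStronglyMeasurable (fun p : X × X => ((a p.1 p.2 : ℝ) : ℂ) * g p.2 * f p.1)
      (μ.prod μ) :=
    (hA.aestronglyMeasurable.mul (Lp.aestronglyMeasurable g).comp_snd).mul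
      (Lp.aestronglyMeasurable f).comp_fst
  refine ⟨hm, ?_⟩
  rw [hasFiniteIntegral_iff_enorm, lintegral_prod _ hm.enorm]
  have h1 : ∫⁻ y, ‖A (absLp g) y‖ₑ * ‖absLp f y‖ₑ ∂μ < ∞ := by
    rw [← (hA.nonnegAE_apply (nonnegAE_absLp g)).enorm_inner (nonnegAE_absLp f)]
    exact enorm_lt_top
  refine lt_of_le_of_lt (lintegral_mono_ae ?_) h1
  filter_upwards [hA.enorm_apply_eq (nonnegAE_absLp g), enorm_coeFn_absLp f,
    ae_aemeasurable_section hA.aemeasurable] with y e1 e2 e3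
  have e5 : AEMeasurable (fun x => (a y x : ℝ≥0∞) * ‖absLp g x‖ₑ) μ :=
    e3.coe_nnreal_ennreal.mul (aemeasurable_enorm _)
  rw [e1, e2, ← lintegral_mul_const'' _ e5]
  refine lintegral_mono_ae ?_
  filter_upwards [enorm_coeFn_absLp g] with x e4
  rw [enorm_mul, enorm_kernel_mul, e4]

/-- The adjoint of an operator with a nonnegative kernel has the transposed kernel. -/
theorem HasKernel.adjoint [SigmaFinite μ] {A : Op μ} {a : X → X → ℝ≥0}
    (hA : HasKernel A fun x y => ((a x y : ℝ) : ℂ)) :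
    HasKernel (ContinuousLinearMap.adjoint A) fun x y => ((a y x : ℝ) : ℂ) := by
  refine ⟨hA.aestronglyMeasurable.prod_swap, fun f => ?_, fun f => ?_⟩
  · obtain ⟨w, hw⟩ := exists_isWeight μ
    filter_upwards [(hA.integrable_prod f hw.toLp).prod_left_ae, hw.coeFn_toLp] with x h1 h2
    have hx : ((w x : ℝ) : ℂ) ≠ 0 := by exact_mod_cast (hw.pos x).ne'
    refine (h1.const_mul ((w x : ℝ) : ℂ)⁻¹).congr (.of_forall fun y => ?_)
    dsimp only
    rw [h2]
    field_simp
  · -- both sides have the same integral over every set of finite measure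
    have hint : ∀ s (hs : MeasurableSet s) (hμs : μ s < ∞), Integrable
        (fun p : X × X => ((a p.1 p.2 : ℝ) : ℂ) * s.indicator (fun _ => (1 : ℂ)) p.2 * f p.1)
          (μ.prod μ) := by
      intro s hs hμs
      refine (hA.integrable_prod f (indicatorConstLp 2 hs hμs.ne (1 : ℂ))).congr ?_
      have h1 : ∀ᵐ p ∂μ.prod μ, indicatorConstLp 2 hs hμs.ne (1 : ℂ) p.2 =
          s.indicator (fun _ => (1 : ℂ)) p.2 :=
        Measure.quasiMeasurePreserving_snd.ae indicatorConstLp_coeFn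
      filter_upwards [h1] with p hp
      rw [hp]
    have hswap : ∀ (s : Set X) (x : X), s.indicator (fun x => ∫ y, ((a y x : ℝ) : ℂ) * f y ∂μ) x =
        ∫ y, ((a y x : ℝ) : ℂ) * s.indicator (fun _ => (1 : ℂ)) x * f y ∂μ := by
      intro s x
      by_cases hx : x ∈ s <;> simp [hx]
    refine ae_eq_of_forall_setIntegral_eq_of_sigmaFinite (fun s hs hμs => ?_)
      (fun s hs hμs => ?_) fun s hs hμs => ?_
    · exact integrableOn_Lp_of_measure_ne_top _ fact_one_le_two_ennreal.elim hμs.ne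
    · rw [← integrable_indicator_iff hs]
      exact (hint s hs hμs).integral_prod_right.congr (.of_forall fun x => (hswap s x).symm)
    · have hg : NonnegAE (indicatorConstLp 2 hs hμs.ne (1 : ℂ)) := by
        filter_upwards [indicatorConstLp_coeFn (p := 2) (hs := hs) (hμs := hμs.ne) (c := (1 : ℂ))]
          with x hx
        rw [hx]
        by_cases hx : x ∈ s <;> simp [hx]
      rw [← L2.inner_indicatorConstLp_one hs hμs.ne, ContinuousLinearMap.adjoint_inner_right,
        L2.inner_def, ← integral_indicator hs]
      simp_rw [hswap s]
      rw [← integral_integral_swap (hint s hs hμs)]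
      refine integral_congr_ae ?_
      filter_upwards [hA.nonnegAE_apply hg, hA.apply_eq (indicatorConstLp 2 hs hμs.ne (1 : ℂ))]
        with y h1 h2
      rw [integral_mul_const, RCLike.inner_apply, h1, mul_comm]
      congr 1
      rw [Complex.conj_ofReal, ← h1, h2]
      refine integral_congr_ae ?_
      filter_upwards [indicatorConstLp_coeFn (p := 2) (hs := hs) (hμs := hμs.ne) (c := (1 : ℂ))]
        with x hx
      rw [hx]

/-- Weights between `α` and `1 - α` are reached by iterating the symmetrization: the element
`A^(β) ∘ (B*)^(1-β)` is the mean of `A^(α) ∘ (B*)^(1-α)` and of the adjoint of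
`B^(α) ∘ (A*)^(1-α)`. -/
theorem geomSymm_subset [SigmaFinite μ] {α β t : ℝ} (hα0 : 0 ≤ α) (hα1 : α ≤ 1) (ht0 : 0 ≤ t)
    (ht1 : t ≤ 1) (hβ : β = α * t + (1 - α) * (1 - t)) (Ψ : Set (Op μ)) :
    geomSymm β Ψ ⊆ geomSymm t (geomSymm α Ψ) := by
  rintro T ⟨A, hAΨ, _, ⟨B, hBΨ, rfl⟩, a, b, ha, hb, hT⟩
  have hα1' := sub_nonneg.2 hα1
  have ht1' := sub_nonneg.2 ht1
  have hbT := hb.adjoint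
  rw [ContinuousLinearMap.adjoint_adjoint] at hbT
  obtain ⟨T₁, hT₁⟩ := exists_hasKernel_mean hα0 hα1' (add_sub_cancel _ _) ha hb
  obtain ⟨T₂, hT₂⟩ := exists_hasKernel_mean (a := fun x y => b y x) (b := fun x y => a y x)
    hα0 hα1' (add_sub_cancel _ _) hbT ha.adjoint
  refine ⟨T₁, ⟨A, hAΨ, _, ⟨B, hBΨ, rfl⟩, a, b, ha, hb, hT₁⟩, _, ⟨T₂, ?_, rfl⟩,
    fun x y => a x y ^ α * b x y ^ (1 - α), fun x y => b x y ^ α * a x y ^ (1 - α), hT₁,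
    HasKernel.adjoint (a := fun x y => b y x ^ α * a y x ^ (1 - α)) hT₂, ?_⟩
  · exact ⟨B, hBΨ, _, ⟨A, hAΨ, rfl⟩, fun x y => b y x, fun x y => a y x, hbT, ha.adjoint, hT₂⟩
  · convert hT using 5 with x y
    have e : ∀ (r : ℝ≥0) {p q : ℝ}, 0 ≤ p → 0 ≤ q → r ^ p * r ^ q = r ^ (p + q) :=
      fun r p q hp hq => (NNReal.rpow_add_of_nonneg r hp hq).symm
    have h1 : 1 - β = (1 - α) * t + α * (1 - t) := by rw [hβ]; ring
    rw [h1, hβ, NNReal.mul_rpow, NNReal.mul_rpow, ← NNReal.rpow_mul, ← NNReal.rpow_mul,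
      ← NNReal.rpow_mul, ← NNReal.rpow_mul, mul_comm (b x y ^ (α * (1 - t))),
      mul_mul_mul_comm, e, e] <;> positivity

/-! ### Sets of operators -/

theorem enorm_le_supNorm {Ψ : Set (Op μ)} {A : Op μ} (hA : A ∈ Ψ) : ‖A‖ₑ ≤ supNorm Ψ :=
  le_iSup₂_of_le A hA le_rfl

theorem supNorm_lt_top_of_isBounded {Ψ : Set (Op μ)} (h : Bornology.IsBounded Ψ) :
    supNorm Ψ < ∞ := by
  obtain ⟨C, hC⟩ := isBounded_iff_forall_norm_le.1 h
  refine lt_of_le_of_lt (iSup₂_le fun A hA => ?_) (ENNReal.ofReal_lt_top (r := C))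
  rw [← ofReal_norm]
  exact ENNReal.ofReal_le_ofReal (hC A hA)

theorem supNorm_mul_le (Ψ Φ : Set (Op μ)) : supNorm (Ψ * Φ) ≤ supNorm Ψ * supNorm Φ := by
  refine iSup₂_le ?_
  rintro _ ⟨A, hA, B, hB, rfl⟩
  have h : ‖A * B‖ₑ ≤ ‖A‖ₑ * ‖B‖ₑ := by
    simp only [enorm_eq_nnnorm]
    exact_mod_cast norm_mul_le A B
  exact h.trans (mul_le_mul' (enorm_le_supNorm hA) (enorm_le_supNorm hB))

theorem supNorm_add_le (Ψ Φ : Set (Op μ)) : supNorm (Ψ + Φ) ≤ supNorm Ψ + supNorm Φ := by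
  refine iSup₂_le ?_
  rintro _ ⟨A, hA, B, hB, rfl⟩
  exact (enorm_add_le A B).trans (add_le_add (enorm_le_supNorm hA) (enorm_le_supNorm hB))

theorem supNorm_one_le : supNorm (1 : Set (Op μ)) ≤ 1 := by
  refine iSup₂_le fun A hA => ?_
  rw [Set.mem_one.1 hA, enorm_eq_nnnorm]
  exact_mod_cast ContinuousLinearMap.norm_id_le (𝕜 := ℂ) (E := Lp ℂ 2 μ)

theorem supNorm_zero : supNorm (0 : Set (Op μ)) = 0 := by
  refine le_antisymm (iSup₂_le fun A hA => ?_) zero_le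
  rw [Set.mem_zero.1 hA, enorm_eq_nnnorm, nnnorm_zero, ENNReal.coe_zero]

theorem supNorm_pow_le (Ψ : Set (Op μ)) (k : ℕ) : supNorm (Ψ ^ k) ≤ supNorm Ψ ^ k := by
  induction k with
  | zero => simpa using supNorm_one_le
  | succ k ih =>
    rw [pow_succ, pow_succ]
    exact (supNorm_mul_le _ _).trans (mul_le_mul' ih le_rfl)

theorem supNorm_list_prod_lt_top {l : List (Set (Op μ))} (h : ∀ Ψ ∈ l, supNorm Ψ < ∞) :
    supNorm l.prod < ∞ := by
  induction l with
  | nil => exact supNorm_one_le.trans_lt ENNReal.one_lt_top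
  | cons Ψ l ih =>
    rw [List.prod_cons]
    exact (supNorm_mul_le _ _).trans_lt (ENNReal.mul_lt_top (h _ List.mem_cons_self)
      (ih fun Φ hΦ => h Φ (List.mem_cons_of_mem _ hΦ)))

theorem supNorm_sum_lt_top {ι : Type*} {s : Finset ι} {Ψ : ι → Set (Op μ)}
    (h : ∀ j ∈ s, supNorm (Ψ j) < ∞) : supNorm (∑ j ∈ s, Ψ j) < ∞ :=
  Finset.sum_induction _ (fun Φ => supNorm Φ < ∞)
    (fun _ _ h1 h2 => (supNorm_add_le _ _).trans_lt (ENNReal.add_lt_top.2 ⟨h1, h2⟩))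
    (by simp [supNorm_zero]) h

/-- Every element of `Φ` is dominated by a weighted geometric mean of an element of `Ψ₁` and the
adjoint of an element of `Ψ₂`. -/
def SetDominated (α : ℝ) (Φ Ψ₁ Ψ₂ : Set (Op μ)) : Prop :=
  ∀ T ∈ Φ, ∃ A ∈ Ψ₁, ∃ B ∈ Ψ₂, Dominated α T A (ContinuousLinearMap.adjoint B)

theorem setDominated_one (α : ℝ) : SetDominated α (1 : Set (Op μ)) 1 1 := by
  rintro _ rfl
  refine ⟨1, rfl, 1, rfl, ?_⟩
  have : ContinuousLinearMap.adjoint (1 : Op μ) = 1 := star_one _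
  rw [this]
  exact dominated_one α

theorem setDominated_zero (α : ℝ) : SetDominated α (0 : Set (Op μ)) 0 0 := by
  rintro _ rfl
  refine ⟨0, rfl, 0, rfl, ?_⟩
  rw [map_zero]
  exact dominated_zero α

/-- Adjoints reverse the order of the factors taken from the second sets. -/
theorem SetDominated.mul {α : ℝ} {Φ Ψ₁ Ψ₂ Φ' Ψ₁' Ψ₂' : Set (Op μ)}
    (h : SetDominated α Φ Ψ₁ Ψ₂) (h' : SetDominated α Φ' Ψ₁' Ψ₂') :
    SetDominated α (Φ * Φ') (Ψ₁ * Ψ₁') (Ψ₂' * Ψ₂) := by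
  rintro _ ⟨T, hT, T', hT', rfl⟩
  obtain ⟨A, hA, B, hB, hd⟩ := h T hT
  obtain ⟨A', hA', B', hB', hd'⟩ := h' T' hT'
  refine ⟨_, Set.mul_mem_mul hA hA', _, Set.mul_mem_mul hB' hB, ?_⟩
  have : ContinuousLinearMap.adjoint (B' * B) =
      ContinuousLinearMap.adjoint B * ContinuousLinearMap.adjoint B' := star_mul B' B
  rw [this]
  exact hd.mul hd'

theorem SetDominated.add {α : ℝ} (h0 : 0 ≤ α) (h1 : α ≤ 1) {Φ Ψ₁ Ψ₂ Φ' Ψ₁' Ψ₂' : Set (Op μ)}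
    (h : SetDominated α Φ Ψ₁ Ψ₂) (h' : SetDominated α Φ' Ψ₁' Ψ₂') :
    SetDominated α (Φ + Φ') (Ψ₁ + Ψ₁') (Ψ₂ + Ψ₂') := by
  rintro _ ⟨T, hT, T', hT', rfl⟩
  obtain ⟨A, hA, B, hB, hd⟩ := h T hT
  obtain ⟨A', hA', B', hB', hd'⟩ := h' T' hT'
  refine ⟨_, Set.add_mem_add hA hA', _, Set.add_mem_add hB hB', ?_⟩
  rw [map_add]
  exact hd.add h0 h1 hd'

theorem SetDominated.pow {α : ℝ} {Φ Ψ₁ Ψ₂ : Set (Op μ)} (h : SetDominated α Φ Ψ₁ Ψ₂) (k : ℕ) :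
    SetDominated α (Φ ^ k) (Ψ₁ ^ k) (Ψ₂ ^ k) := by
  induction k with
  | zero => simpa only [pow_zero] using setDominated_one α
  | succ k ih =>
    rw [pow_succ, pow_succ, pow_succ']
    exact ih.mul h

theorem SetDominated.list_prod {ι : Type*} {α : ℝ} {Φ Ψ : ι → Set (Op μ)}
    (h : ∀ i, SetDominated α (Φ i) (Ψ i) (Ψ i)) (l : List ι) :
    SetDominated α (l.map Φ).prod (l.map Ψ).prod (l.map Ψ).reverse.prod := by
  induction l with
  | nil => simpa using setDominated_one α
  | cons i l ih =>
    simp only [List.map_cons, List.prod_cons, List.reverse_cons, List.prod_append, List.prod_nil,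
      mul_one]
    exact (h i).mul ih

theorem SetDominated.sum {ι : Type*} {α : ℝ} (h0 : 0 ≤ α) (h1 : α ≤ 1) {Φ Ψ : ι → Set (Op μ)}
    (h : ∀ i, SetDominated α (Φ i) (Ψ i) (Ψ i)) (s : Finset ι) :
    SetDominated α (∑ i ∈ s, Φ i) (∑ i ∈ s, Ψ i) (∑ i ∈ s, Ψ i) := by
  classical
  induction s using Finset.induction_on with
  | empty => simpa only [Finset.sum_empty] using setDominated_zero α
  | insert i s hi ih =>
    simp only [Finset.sum_insert hi]
    exact (h i).add h0 h1 ih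

theorem setDominated_geomSymm [SFinite μ] {α : ℝ} (h0 : 0 ≤ α) (h1 : α ≤ 1) (Ψ : Set (Op μ)) :
    SetDominated α (geomSymm α Ψ) Ψ Ψ := by
  rintro T ⟨A, hA, _, ⟨B, hB, rfl⟩, a, b, ha, hb, hT⟩
  exact ⟨A, hA, B, hB, dominated_of_hasKernel h0 h1 ha hb hT⟩

theorem supNorm_geomSymm_le [SFinite μ] {α : ℝ} (h0 : 0 ≤ α) (h1 : α ≤ 1) (Ψ : Set (Op μ)) :
    supNorm (geomSymm α Ψ) ≤ supNorm Ψ := by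
  refine iSup₂_le fun T hT => ?_
  obtain ⟨A, hA, B, hB, hd⟩ := setDominated_geomSymm h0 h1 Ψ T hT
  refine (hd.enorm_le_rpow h0 h1).trans ?_
  rw [enorm_adjoint]
  have := sub_nonneg.2 h1
  calc ‖A‖ₑ ^ α * ‖B‖ₑ ^ (1 - α) ≤ supNorm Ψ ^ α * supNorm Ψ ^ (1 - α) := by
        gcongr <;> exact enorm_le_supNorm ‹_›
    _ = supNorm Ψ := rpow_mul_rpow_one_sub h0 h1 _

/-- All operators in the set are compact on the order interval given by `w`. -/
def SetAMCompact (w : X → ℝ≥0) (Φ : Set (Op μ)) : Prop := ∀ T ∈ Φ, IsAMCompact w T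

theorem SetAMCompact.mul_left {w : X → ℝ≥0} {Φ : Set (Op μ)} (h : SetAMCompact w Φ)
    (Ψ : Set (Op μ)) : SetAMCompact w (Ψ * Φ) := by
  rintro _ ⟨S, -, T, hT, rfl⟩
  exact (h T hT).mul_left S

theorem SetAMCompact.pow {w : X → ℝ≥0} {Φ : Set (Op μ)} (h : SetAMCompact w Φ) {k : ℕ}
    (hk : k ≠ 0) : SetAMCompact w (Φ ^ k) := by
  obtain ⟨j, rfl⟩ := Nat.exists_eq_succ_of_ne_zero hk
  rw [Nat.succ_eq_add_one, pow_succ]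
  exact h.mul_left _

theorem setAMCompact_list_prod {w : X → ℝ≥0} {l : List (Set (Op μ))} (hl : l ≠ [])
    (h : ∀ Φ ∈ l, SetAMCompact w Φ) : SetAMCompact w l.prod := by
  rw [← List.dropLast_append_getLast hl, List.prod_append, List.prod_singleton]
  exact (h _ (List.getLast_mem hl)).mul_left _

theorem setAMCompact_sum {ι : Type*} {w : X → ℝ≥0} {s : Finset ι} {Φ : ι → Set (Op μ)}
    (h : ∀ j ∈ s, SetAMCompact w (Φ j)) : SetAMCompact w (∑ j ∈ s, Φ j) := by
  refine Finset.sum_induction _ (SetAMCompact w) ?_ ?_ h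
  · rintro Ψ₁ Ψ₂ h1 h2 _ ⟨S, hS, T, hT, rfl⟩
    exact (h1 S hS).add (h2 T hT)
  · rintro _ rfl
    exact isAMCompact_zero w

theorem setAMCompact_geomSymm [SigmaFinite μ] {w : X → ℝ≥0} (hw : IsWeight w μ) (α : ℝ)
    (Ψ : Set (Op μ)) : SetAMCompact w (geomSymm α Ψ) := by
  rintro T ⟨A, -, _, -, a, b, -, -, hT⟩
  exact HasKernel.isAMCompact (t := fun x y => a x y ^ α * b x y ^ (1 - α)) hw hT

/-! ### Quantities that respect domination -/

/-- The properties shared by the norm, the numerical radius, the spectral radii and the measure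
of non-compactness of a single operator. -/
structure IsGeomConvex (w : X → ℝ≥0) (φ : Op μ → ℝ≥0∞) : Prop where
  le_enorm : ∀ A, φ A ≤ ‖A‖ₑ
  adjoint : ∀ A, φ (ContinuousLinearMap.adjoint A) = φ A
  le_of_dominated : ∀ {α : ℝ}, 0 ≤ α → α ≤ 1 → ∀ {T A B : Op μ}, Dominated α T A B →
    IsAMCompact w T → φ T ≤ φ A ^ α * φ B ^ (1 - α)

theorem isGeomConvex_enorm (w : X → ℝ≥0) : IsGeomConvex w fun A : Op μ => ‖A‖ₑ :=
  ⟨fun _ => le_rfl, enorm_adjoint, fun h0 h1 _ _ _ h _ => h.enorm_le_rpow h0 h1⟩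

theorem isGeomConvex_numRadius (w : X → ℝ≥0) : IsGeomConvex w (numRadius : Op μ → ℝ≥0∞) :=
  ⟨numRadius_le_enorm, numRadius_adjoint, fun h0 h1 _ _ _ h _ => h.numRadius_le h0 h1⟩

theorem isGeomConvex_spectralRadius (w : X → ℝ≥0) :
    IsGeomConvex w fun A : Op μ => spectralRadius ℂ A :=
  ⟨spectralRadius_le_enorm, spectralRadius_adjoint,
    fun h0 h1 _ _ _ h _ => h.spectralRadius_le h0 h1⟩

theorem isGeomConvex_hausdorffMeas {w : X → ℝ≥0} (hw : IsWeight w μ) :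
    IsGeomConvex w (hausdorffMeas : Op μ → ℝ≥0∞) :=
  ⟨hausdorffMeas_le_enorm, hausdorffMeas_adjoint,
    fun h0 h1 _ _ _ h hT => h.hausdorffMeas_le h0 h1 hw hT⟩

theorem isGeomConvex_essRadius {w : X → ℝ≥0} (hw : IsWeight w μ) :
    IsGeomConvex w (essRadius : Op μ → ℝ≥0∞) :=
  ⟨essRadius_le_enorm, essRadius_adjoint, fun h0 h1 _ _ _ h hT => h.essRadius_le h0 h1 hw hT⟩

/-- The corresponding properties of a quantity attached to sets of operators. -/
structure IsSetGeomConvex (w : X → ℝ≥0) (ρ : Set (Op μ) → ℝ≥0∞) : Prop where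
  mono : ∀ {Ψ Φ : Set (Op μ)}, Ψ ⊆ Φ → ρ Ψ ≤ ρ Φ
  le_supNorm : ∀ Ψ, ρ Ψ ≤ supNorm Ψ
  le_of_setDominated : ∀ {α : ℝ}, 0 ≤ α → α ≤ 1 → ∀ {Φ Ψ₁ Ψ₂ : Set (Op μ)},
    SetDominated α Φ Ψ₁ Ψ₂ → SetAMCompact w Φ → supNorm Ψ₁ < ∞ → supNorm Ψ₂ < ∞ →
      ρ Φ ≤ ρ Ψ₁ ^ α * ρ Ψ₂ ^ (1 - α)

theorem IsGeomConvex.iSup_le_of_setDominated {w : X → ℝ≥0} {φ : Op μ → ℝ≥0∞}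
    (h : IsGeomConvex w φ) {α : ℝ} (h0 : 0 ≤ α) (h1 : α ≤ 1) {Φ Ψ₁ Ψ₂ : Set (Op μ)}
    (hd : SetDominated α Φ Ψ₁ Ψ₂) (hΦ : SetAMCompact w Φ) :
    ⨆ A ∈ Φ, φ A ≤ (⨆ A ∈ Ψ₁, φ A) ^ α * (⨆ A ∈ Ψ₂, φ A) ^ (1 - α) := by
  refine iSup₂_le fun T hT => ?_
  obtain ⟨A, hA, B, hB, hdT⟩ := hd T hT
  refine (h.le_of_dominated h0 h1 hdT (hΦ T hT)).trans ?_
  rw [h.adjoint]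
  exact mul_le_mul' (ENNReal.rpow_le_rpow (le_iSup₂_of_le A hA le_rfl) h0)
    (ENNReal.rpow_le_rpow (le_iSup₂_of_le B hB le_rfl) (sub_nonneg.2 h1))

theorem IsGeomConvex.isSetGeomConvex_iSup {w : X → ℝ≥0} {φ : Op μ → ℝ≥0∞}
    (h : IsGeomConvex w φ) : IsSetGeomConvex w fun Ψ => ⨆ A ∈ Ψ, φ A where
  mono hsub := biSup_mono fun _ hA => hsub hA
  le_supNorm _ := iSup₂_mono fun A _ => h.le_enorm A
  le_of_setDominated h0 h1 _ _ _ hd hΦ _ _ := h.iSup_le_of_setDominated h0 h1 hd hΦ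

theorem limsup_rpow_mul_rpow_le {α : ℝ} (h0 : 0 ≤ α) (h1 : α ≤ 1) {u v w : ℕ → ℝ≥0∞}
    (h : ∀ᶠ k in atTop, u k ≤ v k ^ α * w k ^ (1 - α)) (hv : limsup v atTop ≠ ∞)
    (hw : limsup w atTop ≠ ∞) :
    limsup u atTop ≤ limsup v atTop ^ α * limsup w atTop ^ (1 - α) := by
  have h1' := sub_nonneg.2 h1
  have e1 : limsup v atTop ^ α = limsup (fun k => v k ^ α) atTop :=
    (ENNReal.monotone_rpow_of_nonneg h0).map_limsup_of_continuousAt v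
      ENNReal.continuous_rpow_const.continuousAt
  have e2 : limsup w atTop ^ (1 - α) = limsup (fun k => w k ^ (1 - α)) atTop :=
    (ENNReal.monotone_rpow_of_nonneg h1').map_limsup_of_continuousAt w
      ENNReal.continuous_rpow_const.continuousAt
  have f1 := ENNReal.rpow_ne_top_of_nonneg h0 hv
  have f2 := ENNReal.rpow_ne_top_of_nonneg h1' hw
  rw [e1] at f1 ⊢
  rw [e2] at f2 ⊢
  exact (limsup_le_limsup h).trans (ENNReal.limsup_mul_le' (.inr f2) (.inl f1))

theorem IsGeomConvex.isSetGeomConvex_limsup {w : X → ℝ≥0} {φ : Op μ → ℝ≥0∞}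
    (h : IsGeomConvex w φ) : IsSetGeomConvex w fun Ψ =>
      limsup (fun k : ℕ => (⨆ A ∈ Ψ ^ k, φ A) ^ (1 / (k : ℝ))) atTop := by
  have hle : ∀ Ψ : Set (Op μ),
      limsup (fun k : ℕ => (⨆ A ∈ Ψ ^ k, φ A) ^ (1 / (k : ℝ))) atTop ≤ supNorm Ψ := by
    intro Ψ
    refine limsup_le_of_le ?_ ((eventually_ne_atTop 0).mono fun k hk => ?_)
    · isBoundedDefault
    calc (⨆ A ∈ Ψ ^ k, φ A) ^ (1 / (k : ℝ)) ≤ (supNorm Ψ ^ k) ^ (1 / (k : ℝ)) := by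
          gcongr
          exact (iSup₂_mono fun A _ => h.le_enorm A).trans (supNorm_pow_le Ψ k)
      _ = supNorm Ψ := by rw [one_div]; exact ENNReal.pow_rpow_inv_natCast hk _
  refine ⟨fun hsub => limsup_le_limsup (.of_forall fun k => ?_), hle,
    fun h0 h1 Φ Ψ₁ Ψ₂ hd hΦ hb1 hb2 => ?_⟩
  · exact ENNReal.rpow_le_rpow
      (biSup_mono fun _ hA => Set.pow_subset_pow_left hsub hA) (by positivity)
  · refine limsup_rpow_mul_rpow_le h0 h1 ((eventually_ne_atTop 0).mono fun k hk => ?_)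
      ((hle Ψ₁).trans_lt hb1).ne ((hle Ψ₂).trans_lt hb2).ne
    have hk0 : (0 : ℝ) ≤ 1 / k := by positivity
    refine (ENNReal.rpow_le_rpow
      (h.iSup_le_of_setDominated h0 h1 (hd.pow k) (hΦ.pow hk)) hk0).trans_eq ?_
    rw [ENNReal.mul_rpow_of_nonneg _ _ hk0, ennreal_rpow_comm,
      ennreal_rpow_comm (⨆ A ∈ Ψ₂ ^ k, φ A)]

theorem isSetGeomConvex_of_mem {w : X → ℝ≥0} (hw : IsWeight w μ) {ρ : Set (Op μ) → ℝ≥0∞}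
    (hρ : ρ ∈ ({genRadius, jointRadius, genEssRadius, jointEssRadius,
      supNorm, supHausdorffMeas, supNumRadius} : Set (Set (Op μ) → ℝ≥0∞))) :
    IsSetGeomConvex w ρ := by
  simp only [Set.mem_insert_iff, Set.mem_singleton_iff] at hρ
  rcases hρ with rfl | rfl | rfl | rfl | rfl | rfl | rfl
  · exact (isGeomConvex_spectralRadius w).isSetGeomConvex_limsup
  · exact (isGeomConvex_enorm w).isSetGeomConvex_limsup
  · exact (isGeomConvex_essRadius hw).isSetGeomConvex_limsup
  · exact (isGeomConvex_hausdorffMeas hw).isSetGeomConvex_limsup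
  · exact (isGeomConvex_enorm w).isSetGeomConvex_iSup
  · exact (isGeomConvex_hausdorffMeas hw).isSetGeomConvex_iSup
  · exact (isGeomConvex_numRadius w).isSetGeomConvex_iSup

/-! ### The geometric mean of the forward and backward products -/

theorem supNorm_forwardProd_lt_top {n m : ℕ} {Ψ : Fin n → Fin m → Set (Op μ)}
    (h : ∀ i j, supNorm (Ψ i j) < ∞) : supNorm (forwardProd Ψ) < ∞ := by
  refine supNorm_list_prod_lt_top fun Φ hΦ => ?_
  obtain ⟨i, rfl⟩ := List.mem_ofFn.1 hΦ
  exact supNorm_sum_lt_top fun j _ => h i j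

theorem supNorm_backwardProd_lt_top {n m : ℕ} {Ψ : Fin n → Fin m → Set (Op μ)}
    (h : ∀ i j, supNorm (Ψ i j) < ∞) : supNorm (backwardProd Ψ) < ∞ := by
  refine supNorm_list_prod_lt_top fun Φ hΦ => ?_
  obtain ⟨i, rfl⟩ := List.mem_ofFn.1 (List.mem_reverse.1 hΦ)
  exact supNorm_sum_lt_top fun j _ => h i j

theorem prodMean_lt_top {n m : ℕ} {w : X → ℝ≥0} {ρ : Set (Op μ) → ℝ≥0∞}
    (hρ : IsSetGeomConvex w ρ) {Ψ : Fin n → Fin m → Set (Op μ)} (h : ∀ i j, supNorm (Ψ i j) < ∞) :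
    prodMean ρ Ψ < ∞ :=
  ENNReal.mul_lt_top
    (ENNReal.rpow_lt_top_of_nonneg (by norm_num)
      ((hρ.le_supNorm _).trans_lt (supNorm_forwardProd_lt_top h)).ne)
    (ENNReal.rpow_lt_top_of_nonneg (by norm_num)
      ((hρ.le_supNorm _).trans_lt (supNorm_backwardProd_lt_top h)).ne)

theorem list_prod_map_subset {ι : Type*} {Ψ Φ : ι → Set (Op μ)} (h : ∀ i, Ψ i ⊆ Φ i)
    (l : List ι) : (l.map Ψ).prod ⊆ (l.map Φ).prod := by
  induction l with
  | nil => exact subset_rfl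
  | cons i l ih => simpa only [List.map_cons, List.prod_cons] using Set.mul_subset_mul (h i) ih

theorem prodMean_mono {n m : ℕ} {w : X → ℝ≥0} {ρ : Set (Op μ) → ℝ≥0∞}
    (hρ : IsSetGeomConvex w ρ) {Ψ Φ : Fin n → Fin m → Set (Op μ)} (h : ∀ i j, Ψ i j ⊆ Φ i j) :
    prodMean ρ Ψ ≤ prodMean ρ Φ := by
  have hsum : ∀ i, ∑ j, Ψ i j ⊆ ∑ j, Φ i j := fun i =>
    Set.finsetSum_subset_finsetSum _ _ _ fun j _ => h i j
  have hf : forwardProd Ψ ⊆ forwardProd Φ := by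
    simp only [forwardProd, List.ofFn_eq_map]
    exact list_prod_map_subset hsum _
  have hb : backwardProd Ψ ⊆ backwardProd Φ := by
    simp only [backwardProd, List.ofFn_eq_map, ← List.map_reverse]
    exact list_prod_map_subset hsum _
  exact mul_le_mul' (ENNReal.rpow_le_rpow (hρ.mono hf) (by norm_num))
    (ENNReal.rpow_le_rpow (hρ.mono hb) (by norm_num))

/-- The forward product of the symmetrizations is dominated by the forward product and the
adjoint of the backward product, and conversely; the weights cancel in the geometric mean. -/
theorem prodMean_geomSymm_le [SigmaFinite μ] {n m : ℕ} {w : X → ℝ≥0} (hw : IsWeight w μ)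
    {ρ : Set (Op μ) → ℝ≥0∞} (hρ : IsSetGeomConvex w ρ) {α : ℝ} (h0 : 0 ≤ α) (h1 : α ≤ 1)
    {Ψ : Fin n → Fin m → Set (Op μ)} (hΨ : ∀ i j, supNorm (Ψ i j) < ∞) :
    prodMean ρ (fun i j => geomSymm α (Ψ i j)) ≤ prodMean ρ Ψ := by
  -- for `n = 0` the products are `{1}`, and the identity need not be compact on order intervals
  obtain rfl | hn := Nat.eq_zero_or_pos n
  · exact le_of_eq (by simp [prodMean, forwardProd, backwardProd])
  have h1' := sub_nonneg.2 h1
  have hdom := fun i => SetDominated.sum h0 h1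
    (fun j => setDominated_geomSymm h0 h1 (Ψ i j)) Finset.univ
  have hne : List.ofFn (fun i => ∑ j, geomSymm α (Ψ i j)) ≠ [] := by
    rw [Ne, List.ofFn_eq_nil_iff]; exact hn.ne'
  have ham : ∀ Φ ∈ List.ofFn (fun i => ∑ j, geomSymm α (Ψ i j)), SetAMCompact w Φ := by
    intro Φ hΦ
    obtain ⟨i, rfl⟩ := List.mem_ofFn.1 hΦ
    exact setAMCompact_sum fun j _ => setAMCompact_geomSymm hw α (Ψ i j)
  have hF := supNorm_forwardProd_lt_top hΨ
  have hB := supNorm_backwardProd_lt_top hΨ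
  have hf : ρ (forwardProd fun i j => geomSymm α (Ψ i j)) ≤
      ρ (forwardProd Ψ) ^ α * ρ (backwardProd Ψ) ^ (1 - α) := by
    refine hρ.le_of_setDominated h0 h1 ?_ (setAMCompact_list_prod hne ham) hF hB
    simpa only [forwardProd, backwardProd, List.ofFn_eq_map] using
      SetDominated.list_prod hdom (List.finRange n)
  have hb : ρ (backwardProd fun i j => geomSymm α (Ψ i j)) ≤
      ρ (backwardProd Ψ) ^ α * ρ (forwardProd Ψ) ^ (1 - α) := by
    refine hρ.le_of_setDominated h0 h1 ?_ (setAMCompact_list_prod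
      (by rwa [Ne, List.reverse_eq_nil_iff]) fun Φ hΦ => ham Φ (List.mem_reverse.1 hΦ)) hB hF
    simpa only [forwardProd, backwardProd, List.ofFn_eq_map, List.map_reverse,
      List.reverse_reverse] using SetDominated.list_prod hdom (List.finRange n).reverse
  have hhalf : (0 : ℝ) ≤ 1 / 2 := by norm_num
  unfold prodMean
  rw [← ENNReal.mul_rpow_of_nonneg _ _ hhalf, ← ENNReal.mul_rpow_of_nonneg _ _ hhalf]
  refine ENNReal.rpow_le_rpow ((mul_le_mul' hf hb).trans_eq ?_) hhalf
  set x := ρ (forwardProd Ψ)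
  set y := ρ (backwardProd Ψ)
  calc x ^ α * y ^ (1 - α) * (y ^ α * x ^ (1 - α))
      = (x ^ α * x ^ (1 - α)) * (y ^ α * y ^ (1 - α)) := by ring
    _ = x * y := by rw [rpow_mul_rpow_one_sub h0 h1, rpow_mul_rpow_one_sub h0 h1]

/-- A weight `β` between `α` and `1 - α` gives a smaller mean than `α`, since `S_β` is contained
in an iterated symmetrization. -/
theorem prodMean_geomSymm_le_of_eq [SigmaFinite μ] {n m : ℕ} {w : X → ℝ≥0} (hw : IsWeight w μ)
    {ρ : Set (Op μ) → ℝ≥0∞} (hρ : IsSetGeomConvex w ρ) {α β t : ℝ} (hα0 : 0 ≤ α) (hα1 : α ≤ 1)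
    (ht0 : 0 ≤ t) (ht1 : t ≤ 1) (hβ : β = α * t + (1 - α) * (1 - t))
    {Ψ : Fin n → Fin m → Set (Op μ)} (hΨ : ∀ i j, supNorm (Ψ i j) < ∞) :
    prodMean ρ (fun i j => geomSymm β (Ψ i j)) ≤ prodMean ρ (fun i j => geomSymm α (Ψ i j)) :=
  (prodMean_mono hρ fun i j => geomSymm_subset hα0 hα1 ht0 ht1 hβ (Ψ i j)).trans
    (prodMean_geomSymm_le hw hρ ht0 ht1
      fun i j => (supNorm_geomSymm_le hα0 hα1 (Ψ i j)).trans_lt (hΨ i j))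

end L2

end KernelOp

open KernelOp MeasureTheory
theorem theorem3p9 {X : Type*} [MeasurableSpace X] (μ : Measure X) [SigmaFinite μ]
    (n m : ℕ) (Ψ : Fin n → Fin m → Set (Op μ))
    (hbdd : ∀ i j, Bornology.IsBounded (Ψ i j))
    (hpos : ∀ i j, ∀ A ∈ Ψ i j, IsPosKernelOp A)
    (ρ : Set (Op μ) → ℝ≥0∞)
    (hρ : ρ ∈ ({genRadius, jointRadius, genEssRadius, jointEssRadius,
      supNorm, supHausdorffMeas, supNumRadius} : Set (Set (Op μ) → ℝ≥0∞))) :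
    (∀ α ∈ Set.Icc (0 : ℝ) 1,
      prodMean ρ (fun i j => geomSymm α (Ψ i j)) < ∞ ∧
      prodMean ρ (fun i j => geomSymm α (Ψ i j)) ≤ prodMean ρ Ψ) ∧
    AntitoneOn (fun α : ℝ => prodMean ρ (fun i j => geomSymm α (Ψ i j))) (Set.Icc 0 (1 / 2)) ∧
    MonotoneOn (fun α : ℝ => prodMean ρ (fun i j => geomSymm α (Ψ i j))) (Set.Icc (1 / 2) 1) := by
  obtain ⟨w, hw⟩ := exists_isWeight μ
  have hρ' := isSetGeomConvex_of_mem hw hρ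
  have hΨ : ∀ i j, supNorm (Ψ i j) < ∞ := fun i j => supNorm_lt_top_of_isBounded (hbdd i j)
  refine ⟨fun α hα => ⟨?_, prodMean_geomSymm_le hw hρ' hα.1 hα.2 hΨ⟩, ?_, ?_⟩
  · exact (prodMean_geomSymm_le hw hρ' hα.1 hα.2 hΨ).trans_lt (prodMean_lt_top hρ' hΨ)
  · rintro α ⟨hα0, hα1⟩ β ⟨hβ0, hβ1⟩ hαβ
    rcases eq_or_lt_of_le hα1 with rfl | hlt
    · rw [le_antisymm hβ1 hαβ]
    have hd : 0 < 1 - 2 * α := by linarith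
    refine prodMean_geomSymm_le_of_eq hw hρ' (t := (1 - α - β) / (1 - 2 * α)) hα0 (by linarith)
      (div_nonneg (by linarith) hd.le) ((div_le_one hd).2 (by linarith)) ?_ hΨ
    have h := div_mul_cancel₀ (1 - α - β) hd.ne'
    linear_combination h
  · rintro β ⟨hβ0, hβ1⟩ α ⟨hα0, hα1⟩ hβα
    rcases eq_or_lt_of_le hα0 with rfl | hlt
    · rw [le_antisymm hβα hβ0]
    have hd : 0 < 2 * α - 1 := by linarith
    refine prodMean_geomSymm_le_of_eq hw hρ' (t := (α + β - 1) / (2 * α - 1)) (by linarith) hα1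
      (div_nonneg (by linarith) hd.le) ((div_le_one hd).2 (by linarith)) ?_ hΨ
    have h := div_mul_cancel₀ (α + β - 1) hd.ne'
    linear_combination -h
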